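/- Let $F$ be a field and $n\ge 1$. For $\Pi=(\delta,\delta_L,\delta_R,\kappa_L,\kappa_R,\kappa)\in F^6$ let $b'_n(\Pi)$ be the symplectic blob algebra: the unital associative $F$-algebra with generators $e,U_1,\dots,U_{n-1},f$ and relations $U_i^2=\delta U_i$; $U_iU_jU_i=U_i$ if $|i-j|=1$; $U_iU_j=U_jU_i$ if $|i-j|\ne1$; $e^2=\delta_Le$; $f^2=\delta_Rf$; $U_1eU_1=\kappa_LU_1$; $U_{n-1}fU_{n-1}=\kappa_RU_{n-1}$; $eU_i=U_ie$ if $i\ne1$; $fU_i=U_if$ if $i\neq n-1$; $ef=fe$ if $n>1$; $IJI=\kappa I$; $JIJ=\kappa J$, where $I=U_1U_3\cdots U_{n-2}f$, $J=eU_2\cdots U_{n-1}$ if $n$ is odd and $I=U_1U_3\cdots U_{n-1}$, $J=eU_2\cdots U_{n-2}f$ if $n$ is even. Put $b'_0(\Pi)=F$. Let $\Sigma=(a,b,c,d,x,y,z,w)\in(F^\times)^8$, write $[2]_q=q+q^{-1}$, and assume that $\delta=[2]_a[2]_b[2]_c[2]_d$, $\delta_L=[2]_x[2]_y$, $\delta_R=[2]_z[2]_w$,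 $\kappa_L=[2]_{ab/x}[2]_{cd/y}$, $\kappa_R=[2]_{ad/w}[2]_{bc/z}$, and $\kappa=[2]_{xy/(zw)}+2$ if $n$ is odd, $\kappa=[2]_{abcd/(xyzw)}+2$ if $n$ is even. Let $\mathcal V(n;\Sigma)=V_2^{\otimes 4n}$ be the space with basis the words $\alpha=\alpha_{-2n+1}\cdots\alpha_{2n}$ in $\{1,2\}$. For $-2n+1\le i\le 2n$ let $R^q_i$ be the operator with $R^q_i\alpha=0$ if $\alpha_i=\alpha_{i+1}$ and otherwise $R^q_i\alpha=q^{2-\alpha_i}\alpha'+q^{1-\alpha_i}\alpha''$, where $\alpha'$ (resp. $\alpha''$) is $\alpha$ with $(\alpha_i,\alpha_{i+1})$ replaced by $(1,2)$ (resp. $(2,1)$); here $\alpha_{2n+1}$ means $\alpha_{-2n+1}$. Then $\mathcal V(n;\Sigma)$ is a $b'_n(\Pi)$-module with $U_i\mapsto R^a_{-n-i}R^b_{-n+i}R^c_{n-i}R^d_{n+i}$, $e\mapsto R^x_{-n}R^y_n$, $f\mapsto R^z_0R^w_{2n}$. Let $M_n(r)\subseteq\mathcal V(n;\Sigma)$ be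 the submodule spanned by the words with exactly $2n+r$ letters $1$ and $2n-r$ letters $2$ ($-2n\le r\le2n$). Put $\Pi_L=(\delta,\kappa_L,\delta_R,\delta_L,\kappa_R,\kappa)$, $\Sigma_L=(a,b,c,d,\tfrac{ab}{x},\tfrac{cd}{y},z,w)$, $\Pi_R=(\delta,\delta_L,\kappa_R,\kappa_L,\delta_R,\kappa)$, $\Sigma_R=(a,b,c,d,x,y,\tfrac{bc}{z},\tfrac{ad}{w})$. If $\delta_L\neq0$ put $\bar e=e/\delta_L$ and let $F_e$ be the functor $M\mapsto\bar eM$ from $b'_n(\Pi)$-modules to $b'_{n-1}(\Pi_L)$-modules, where $b'_{n-1}(\Pi_L)$ acts through the algebra homomorphism to $\bar e\,b'_n(\Pi)\,\bar e$ given (for $n\ge2$) by $e\mapsto\delta_L\,\bar eU_1\bar e$, $U_i\mapsto\bar eU_{i+1}\bar e$, $f\mapsto\bar ef\bar e$. If $\delta_R\ne0$ put $\bar f=f/\delta_R$ and let $F_f$ be the functor $M\mapsto\bar fM$ to $b'_{n-1}(\Pi_R)$-modules, acting through $f\mapsto\delta_R\,\bar fU_{n-1}\bar f$, $U_i\mapsto\bar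 fU_i\bar f$, $e\mapsto\bar fe\bar f$. Then for every integer $r$ with $-2n\le r\le 2n$: (1) if $\delta_L\neq 0$, then $F_eM_n(r)\cong M_{n-1}(r)$ (inside $\mathcal V(n-1;\Sigma_L)$) as $b'_{n-1}(\Pi_L)$-modules if $|r|\le 2(n-1)$, and $F_eM_n(r)=0$ if $|r|>2(n-1)$; (2) if $\delta_R\neq 0$, then $F_fM_n(r)\cong M_{n-1}(r)$ (inside $\mathcal V(n-1;\Sigma_R)$) as $b'_{n-1}(\Pi_R)$-modules if $|r|\le 2(n-1)$, and $F_fM_n(r)=0$ if $|r|>2(n-1)$. -/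

import Mathlib

/-!
The symplectic blob algebras, their localisation functors, and the tensor space modules with their
permutation submodules.  All theorems below are auxiliary: they verify that the defining relations
hold wherever a homomorphism out of a presented algebra is needed.
-/

namespace SympBlob

universe u

/-- The six parameters `(δ, δ_L, δ_R, κ_L, κ_R, κ)` of a symplectic blob algebra. -/
structure Params (K : Type u) where
  δ : K
  δL : K
  δR : K
  κL : K
  κR : K
  κ : K

/-- `Π_L = (δ, κ_L, δ_R, δ_L, κ_R, κ)`. -/
def Params.left {K : Type u} (P : Params K) : Params K :=
  ⟨P.δ, P.κL, P.δR, P.δL, P.κR, P.κ⟩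

/-- `Π_R = (δ, δ_L, κ_R, κ_L, δ_R, κ)`. -/
def Params.right {K : Type u} (P : Params K) : Params K :=
  ⟨P.δ, P.δL, P.κR, P.κL, P.δR, P.κ⟩

/-- The generators of `b'_n`.  For `n + 1 ≥ 1` they are `e`, `f` and `U_1, …, U_n`, where
`Gen.U i` (`i : Fin n`) stands for `U_{i+1}`.  For `n = 0` there are none, so `b'_0` is the ground
field. -/
inductive Gen : ℕ → Type
  | e {n : ℕ} : Gen (n + 1)
  | f {n : ℕ} : Gen (n + 1)
  | U {n : ℕ} (i : Fin n) : Gen (n + 1)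

section words

variable {A : Type*} [Monoid A]

/-- `U_1 U_3 U_5 ⋯`, over all odd indices in `{1, …, n}`, in increasing order. -/
def oddProd {n : ℕ} (U : Fin n → A) : A :=
  (((List.finRange n).filter fun i => i.val % 2 = 0).map U).prod

/-- `U_2 U_4 U_6 ⋯`, over all even indices in `{1, …, n}`, in increasing order. -/
def evenProd {n : ℕ} (U : Fin n → A) : A :=
  (((List.finRange n).filter fun i => i.val % 2 = 1).map U).prod

/-- The word `I` of `b'_{n+1}`. -/
def wordI {n : ℕ} (f : A) (U : Fin n → A) : A :=
  if Odd (n + 1) then oddProd U * f else oddProd U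

/-- The word `J` of `b'_{n+1}`. -/
def wordJ {n : ℕ} (e f : A) (U : Fin n → A) : A :=
  if Odd (n + 1) then e * evenProd U else e * evenProd U * f

end words

/-- The defining relations of `b'_{n+1}`, for elements `e`, `f`, `U_1, …, U_n` of a `K`-algebra
(`U i` stands for `U_{i+1}`). -/
inductive Relation {K : Type u} [CommRing K] (P : Params K) {A : Type*} [Ring A] [Algebra K A]
    (n : ℕ) (e f : A) (U : Fin n → A) : A → A → Prop
  | U_sq (i : Fin n) : Relation P n e f U (U i * U i) (P.δ • U i)
  | U_braid (i j : Fin n) (h : i.val + 1 = j.val ∨ j.val + 1 = i.val) :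
      Relation P n e f U (U i * U j * U i) (U i)
  | U_comm (i j : Fin n) (h : ¬ (i.val + 1 = j.val ∨ j.val + 1 = i.val)) :
      Relation P n e f U (U i * U j) (U j * U i)
  | e_sq : Relation P n e f U (e * e) (P.δL • e)
  | f_sq : Relation P n e f U (f * f) (P.δR • f)
  | U_e_U (i : Fin n) (h : i.val = 0) : Relation P n e f U (U i * e * U i) (P.κL • U i)
  | U_f_U (i : Fin n) (h : i.val + 1 = n) : Relation P n e f U (U i * f * U i) (P.κR • U i)
  | e_U (i : Fin n) (h : i.val ≠ 0) : Relation P n e f U (e * U i) (U i * e)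
  | f_U (i : Fin n) (h : i.val + 1 ≠ n) : Relation P n e f U (f * U i) (U i * f)
  | e_f (h : 1 < n + 1) : Relation P n e f U (e * f) (f * e)
  | I_J_I : Relation P n e f U (wordI f U * wordJ e f U * wordI f U) (P.κ • wordI f U)
  | J_I_J : Relation P n e f U (wordJ e f U * wordI f U * wordJ e f U) (P.κ • wordJ e f U)

/-- The relations imposed on the free algebra on `Gen n`. -/
inductive Rel {K : Type u} [CommRing K] (P : Params K) :
    (n : ℕ) → FreeAlgebra K (Gen n) → FreeAlgebra K (Gen n) → Prop
  | of {n : ℕ} {x y : FreeAlgebra K (Gen (n + 1))}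
      (h : Relation P n (FreeAlgebra.ι K Gen.e) (FreeAlgebra.ι K Gen.f)
        (fun i => FreeAlgebra.ι K (Gen.U i)) x y) : Rel P (n + 1) x y

/-- The symplectic blob algebra `b'_n(δ, δ_L, δ_R, κ_L, κ_R, κ)`. -/
abbrev Blob {K : Type u} [CommRing K] (n : ℕ) (P : Params K) : Type u := RingQuot (Rel P n)

section algebra

variable {K : Type u} [Field K] {n : ℕ} (P : Params K)

/-- A generator, as an element of `b'_n`. -/
def Blob.gen (g : Gen n) : Blob n P := RingQuot.mkAlgHom K (Rel P n) (FreeAlgebra.ι K g)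

theorem map_oddProd {A B : Type*} [Monoid A] [Monoid B] (φ : A →* B) (U : Fin n → A) :
    φ (oddProd U) = oddProd (fun i => φ (U i)) := by
  simp [oddProd, map_list_prod, Function.comp_def]

theorem map_evenProd {A B : Type*} [Monoid A] [Monoid B] (φ : A →* B) (U : Fin n → A) :
    φ (evenProd U) = evenProd (fun i => φ (U i)) := by
  simp [evenProd, map_list_prod, Function.comp_def]

theorem map_wordI {A B : Type*} [Monoid A] [Monoid B] (φ : A →* B) (f : A) (U : Fin n → A) :
    φ (wordI f U) = wordI (φ f) (fun i => φ (U i)) := by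
  unfold wordI; split_ifs <;> simp [map_oddProd]

theorem map_wordJ {A B : Type*} [Monoid A] [Monoid B] (φ : A →* B) (e f : A) (U : Fin n → A) :
    φ (wordJ e f U) = wordJ (φ e) (φ f) (fun i => φ (U i)) := by
  unfold wordJ; split_ifs <;> simp [map_evenProd]

theorem Relation.map {A B : Type*} [Ring A] [Algebra K A] [Ring B] [Algebra K B] (φ : A →ₐ[K] B)
    {e f : A} {U : Fin n → A} {x y : A} (h : Relation P n e f U x y) :
    Relation P n (φ e) (φ f) (fun i => φ (U i)) (φ x) (φ y) := by
  have hI : φ (wordI f U) = wordI (φ f) (fun i => φ (U i)) := map_wordI (φ : A →* B) f U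
  have hJ : φ (wordJ e f U) = wordJ (φ e) (φ f) (fun i => φ (U i)) :=
    map_wordJ (φ : A →* B) e f U
  cases h <;> simp only [map_mul, map_smul, hI, hJ] <;> constructor <;> assumption

/-- Elements of an algebra that satisfy the defining relations. -/
def Satisfies {A : Type*} [Ring A] [Algebra K A] (e f : A) (U : Fin n → A) : Prop :=
  ∀ x y, Relation P n e f U x y → x = y

theorem Blob.satisfies :
    Satisfies P (Blob.gen P Gen.e) (Blob.gen P Gen.f) (fun i : Fin n => Blob.gen P (Gen.U i)) := by
  have key : ∀ x y, Relation P n (FreeAlgebra.ι K Gen.e) (FreeAlgebra.ι K Gen.f)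
      (fun i => FreeAlgebra.ι K (Gen.U i)) x y →
      RingQuot.mkAlgHom K (Rel P (n + 1)) x = RingQuot.mkAlgHom K (Rel P (n + 1)) y :=
    fun x y h => RingQuot.mkAlgHom_rel K (Rel.of h)
  have hI := map_wordI ((RingQuot.mkAlgHom K (Rel P (n + 1)) : _ →ₐ[K] _) :
    FreeAlgebra K (Gen (n + 1)) →* Blob (n + 1) P)
    (FreeAlgebra.ι K Gen.f) (fun i : Fin n => FreeAlgebra.ι K (Gen.U i))
  have hJ := map_wordJ ((RingQuot.mkAlgHom K (Rel P (n + 1)) : _ →ₐ[K] _) :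
    FreeAlgebra K (Gen (n + 1)) →* Blob (n + 1) P)
    (FreeAlgebra.ι K Gen.e) (FreeAlgebra.ι K Gen.f) (fun i : Fin n => FreeAlgebra.ι K (Gen.U i))
  simp only [MonoidHom.coe_coe] at hI hJ
  intro x y h
  cases h <;> unfold Blob.gen <;> simp only [← hI, ← hJ, ← map_mul, ← map_smul] <;>
    apply key <;> constructor <;> assumption

/-- The values of an assignment of the generators of `b'_{n+1}`. -/
def genVal {A : Type*} (e f : A) (U : Fin n → A) : Gen (n + 1) → A
  | Gen.e => e
  | Gen.f => f
  | Gen.U i => U i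

/-- The universal property of the presentation of `b'_{n+1}`. -/
def Blob.lift {A : Type*} [Ring A] [Algebra K A] (e f : A) (U : Fin n → A)
    (h : Satisfies P e f U) : Blob (n + 1) P →ₐ[K] A :=
  RingQuot.liftAlgHom K ⟨FreeAlgebra.lift K (genVal e f U), by
    rintro x y ⟨hxy⟩
    have := hxy.map P (FreeAlgebra.lift K (genVal e f U))
    simp only [FreeAlgebra.lift_ι_apply, genVal] at this
    exact h _ _ this⟩

/-- `b'_0` is the ground field: its structure morphism to any algebra. -/
def Blob.lift₀ {A : Type*} [Semiring A] [Algebra K A] : Blob 0 P →ₐ[K] A :=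
  RingQuot.liftAlgHom K ⟨FreeAlgebra.lift K (fun g : Gen 0 => nomatch g), by rintro x y ⟨⟩⟩

@[simp] theorem Blob.lift_gen {A : Type*} [Ring A] [Algebra K A] (e f : A) (U : Fin n → A)
    (h : Satisfies P e f U) (g : Gen (n + 1)) :
    Blob.lift P e f U h (Blob.gen P g) = genVal e f U g := by
  simp [Blob.lift, Blob.gen]

end algebra


section corner

variable {K : Type u} [Field K]

instance cornerModule {A : Type*} [Ring A] [Algebra K A] {p : A} (hp : IsIdempotentElem p) :
    Module K hp.Corner where
  smul c x := ⟨c • x.1, by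
    obtain ⟨y, hy⟩ := x.2
    exact ⟨c • y, by simp [← hy]⟩⟩
  one_smul x := Subtype.ext (one_smul K x.1)
  mul_smul c d x := Subtype.ext (mul_smul c d x.1)
  smul_zero c := Subtype.ext (smul_zero c)
  smul_add c x y := Subtype.ext (smul_add c x.1 y.1)
  add_smul c d x := Subtype.ext (add_smul c d x.1)
  zero_smul x := Subtype.ext (zero_smul K x.1)

/-- The corner `p A p` of a `K`-algebra at an idempotent is a `K`-algebra (with unit `p`). -/
instance cornerAlgebra {A : Type*} [Ring A] [Algebra K A] {p : A} (hp : IsIdempotentElem p) :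
    Algebra K hp.Corner :=
  Algebra.ofModule (fun c x y => Subtype.ext (smul_mul_assoc c x.1 y.1))
    (fun c x y => Subtype.ext (mul_smul_comm c x.1 y.1))

/-- The element `p a p` of the corner `p A p`. -/
def toCorner {A : Type*} [Ring A] {p : A} (hp : IsIdempotentElem p) (a : A) : hp.Corner :=
  ⟨p * a * p, a, rfl⟩

section

variable {A : Type*} [Ring A] [Algebra K A] {p : A} (hp : IsIdempotentElem p)

theorem corner_val_mul (x y : hp.Corner) : (x * y).1 = x.1 * y.1 := rfl
theorem corner_val_smul (c : K) (x : hp.Corner) : (c • x).1 = c • x.1 := rfl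
theorem corner_val_one : (1 : hp.Corner).1 = p := rfl

theorem toCorner_val (a : A) : (toCorner hp a).1 = p * a * p := rfl

theorem toCorner_val' {a : A} (h : p * a = a * p) : (toCorner hp a).1 = p * a := by
  rw [toCorner_val, mul_assoc, ← h, ← mul_assoc, hp.eq]

theorem corner_list_prod {ι : Type*} (l : List ι) (u : ι → A) (v : ι → hp.Corner)
    (h : ∀ i ∈ l, (v i).1 = p * u i ∧ p * u i = u i * p) :
    ((l.map v).prod).1 = p * (l.map u).prod ∧
      p * (l.map u).prod = (l.map u).prod * p := by
  induction l with
  | nil => simp [corner_val_one]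
  | cons a l ih =>
    obtain ⟨h1, h2⟩ := h a (by simp)
    obtain ⟨h3, h4⟩ := ih fun i hi => h i (by simp [hi])
    simp only [List.map_cons, List.prod_cons, corner_val_mul, h1, h3]
    constructor
    · rw [h2, mul_assoc, ← mul_assoc p p, hp.eq, ← mul_assoc, ← h2, mul_assoc]
    · rw [mul_assoc, ← h4, ← mul_assoc, ← mul_assoc, h2]

end

theorem oddProd_succ {A : Type*} [Monoid A] {n : ℕ} (U : Fin (n + 1) → A) :
    oddProd U = U 0 * evenProd (fun i : Fin n => U i.succ) := by
  have : ∀ i : Fin n, ((i.val + 1) % 2 = 0) ↔ (i.val % 2 = 1) := fun i => by omega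
  simp [oddProd, evenProd, List.finRange_succ, List.filter_map, Function.comp_def, this]

theorem evenProd_succ {A : Type*} [Monoid A] {n : ℕ} (U : Fin (n + 1) → A) :
    evenProd U = oddProd (fun i : Fin n => U i.succ) := by
  have : ∀ i : Fin n, ((i.val + 1) % 2 = 1) ↔ (i.val % 2 = 0) := fun i => by omega
  simp [oddProd, evenProd, List.finRange_succ, List.filter_map, Function.comp_def, this]

theorem oddProd_castSucc {A : Type*} [Monoid A] {n : ℕ} (U : Fin (n + 1) → A) :
    oddProd U = oddProd (fun i : Fin n => U i.castSucc) *
      (if n % 2 = 0 then U (Fin.last n) else 1) := by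
  by_cases h : n % 2 = 0 <;>
  simp [oddProd, List.finRange_succ_last, List.filter_map, Function.comp_def, h]

theorem evenProd_castSucc {A : Type*} [Monoid A] {n : ℕ} (U : Fin (n + 1) → A) :
    evenProd U = evenProd (fun i : Fin n => U i.castSucc) *
      (if n % 2 = 1 then U (Fin.last n) else 1) := by
  by_cases h : n % 2 = 1 <;>
  simp [evenProd, List.finRange_succ_last, List.filter_map, Function.comp_def, h]

/-- Localising the pair of relations `XYX = κX`, `YXY = κY`. -/
theorem localise_pair {A : Type*} [Ring A] [Algebra K A] {p X Y : A} {d k : K} (hd : d ≠ 0)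
    (h1 : X * Y * X = k • X) (h2 : Y * X * Y = k • Y) (hpY : p * Y = Y) (hYp : Y * p = Y) :
    (d⁻¹ • Y) * (d • (p * X * p)) * (d⁻¹ • Y) = k • (d⁻¹ • Y) ∧
    (d • (p * X * p)) * (d⁻¹ • Y) * (d • (p * X * p)) = k • (d • (p * X * p)) := by
  constructor
  · have : Y * (p * X * p) * Y = k • Y := by
      rw [← h2]; simp only [← mul_assoc, hYp]; rw [mul_assoc _ p Y, hpY]
    simp only [smul_mul_assoc, mul_smul_comm, this, smul_smul]
    congr 1; field_simp
  · have : (p * X * p) * Y * (p * X * p) = k • (p * X * p) := by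
      have e : (p * X * p) * Y * (p * X * p) = p * (X * (p * Y * p) * X) * p := by noncomm_ring
      rw [e, hpY, hYp, h1]; simp
    simp only [smul_mul_assoc, mul_smul_comm, this, smul_smul]
    congr 1; field_simp

variable {A : Type*} [Ring A] [Algebra K A] {n : ℕ} {P : Params K}
  {e f : A} {U : Fin (n + 1) → A} {p : A}

theorem mul4 {p a b : A} (hp : p * p = p) (ha : p * a = a * p) :
    p * a * (p * b) = p * (a * b) := by
  rw [ha, mul_assoc, ← mul_assoc p p, hp, ← mul_assoc, ← ha, mul_assoc]

theorem mul_sand {x a : A} (hp : p * p = p) (ha : p * a = a * p) :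
    (p * a) * (p * x * p) = p * (a * x) * p := by
  rw [mul_assoc p x p, mul4 hp ha]
  simp only [mul_assoc]

theorem sand_mul {x a : A} (hp : p * p = p) (ha : p * a = a * p) :
    (p * x * p) * (p * a) = p * (x * a) * p := by
  rw [ha, mul_assoc (p * x), ← mul_assoc p a, ha, mul_assoc a, hp]
  simp only [mul_assoc]

theorem comm_mul {a b : A} (ha : p * a = a * p) (hb : p * b = b * p) :
    p * (a * b) = a * b * p := by
  rw [← mul_assoc, ha, mul_assoc, hb, mul_assoc]

theorem sand_comm {a : A} (hp : p * p = p) (ha : p * a = a * p) : p * a * p = p * a := by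
  rw [ha, mul_assoc, hp]

theorem satisfies_left (hP : P.δL ≠ 0) (H : Satisfies P e f U) (hp : IsIdempotentElem p)
    (he : p = P.δL⁻¹ • e) :
    Satisfies P.left (P.δL • toCorner hp (U 0)) (toCorner hp f)
      (fun i : Fin n => toCorner hp (U i.succ)) := by
  have cU : ∀ i : Fin n, p * U i.succ = U i.succ * p := fun i => by
    have := H _ _ (.e_U i.succ (by simp))
    simp [he, this]
  have cf : p * f = f * p := by
    by_cases hn : 1 < n + 1 + 1
    · simp [he, H _ _ (.e_f hn)]
    · omega
  have vU : ∀ i : Fin n, (toCorner hp (U i.succ)).1 = p * U i.succ := fun i => toCorner_val' hp (cU i)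
  have vf : (toCorner hp f).1 = p * f := toCorner_val' hp cf
  have UpU : U 0 * p * U 0 = (P.δL⁻¹ * P.κL) • U 0 := by
    have := H _ _ (.U_e_U 0 rfl)
    simp [he, this, smul_smul]
  have eO := corner_list_prod hp ((List.finRange n).filter fun i => i.val % 2 = 0)
    (fun i => U i.succ) (fun i => toCorner hp (U i.succ)) fun i _ => ⟨vU i, cU i⟩
  have eE := corner_list_prod hp ((List.finRange n).filter fun i => i.val % 2 = 1)
    (fun i => U i.succ) (fun i => toCorner hp (U i.succ)) fun i _ => ⟨vU i, cU i⟩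
  change (oddProd fun i : Fin n => toCorner hp (U i.succ)).1 = p * oddProd (fun i : Fin n => U i.succ)
    ∧ p * oddProd (fun i : Fin n => U i.succ) = oddProd (fun i : Fin n => U i.succ) * p at eO
  change (evenProd fun i : Fin n => toCorner hp (U i.succ)).1 =
    p * evenProd (fun i : Fin n => U i.succ)
    ∧ p * evenProd (fun i : Fin n => U i.succ) = evenProd (fun i : Fin n => U i.succ) * p at eE
  have he' : e = P.δL • p := by rw [he, smul_smul, mul_inv_cancel₀ hP, one_smul]
  set O := oddProd (fun i : Fin n => U i.succ) with hO
  set E := evenProd (fun i : Fin n => U i.succ) with hE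
  -- the two long words
  have hJp : p * wordJ e f U = wordJ e f U ∧ wordJ e f U * p = wordJ e f U := by
    unfold wordJ
    rw [evenProd_succ, ← hO, he']
    split_ifs
    · simp only [smul_mul_assoc, mul_smul_comm, ← mul_assoc, hp.eq, true_and]
      rw [mul_assoc, ← eO.2, ← mul_assoc, hp.eq]
    · simp only [smul_mul_assoc, mul_smul_comm, ← mul_assoc, hp.eq, true_and]
      rw [mul_assoc, ← cf, mul_assoc, ← mul_assoc O p f, ← eO.2, mul_assoc, ← mul_assoc, hp.eq,
        ← mul_assoc]
  have wI : (wordI (toCorner hp f) (fun i : Fin n => toCorner hp (U i.succ))).1 =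
      P.δL⁻¹ • wordJ e f U := by
    unfold wordI wordJ
    rw [evenProd_succ, ← hO, he']
    by_cases h : Odd (n + 1)
    · have h' : ¬ Odd (n + 1 + 1) := by grind
      simp only [h, h', if_true, if_false, corner_val_mul, eO.1, vf]
      rw [mul4 hp.eq eO.2]
      simp [smul_smul, inv_mul_cancel₀ hP, mul_assoc]
    · have h' : Odd (n + 1 + 1) := by grind
      simp only [h, h', if_true, if_false, eO.1]
      simp [smul_smul, inv_mul_cancel₀ hP]
  have wJ : (wordJ (P.δL • toCorner hp (U 0)) (toCorner hp f)
      (fun i : Fin n => toCorner hp (U i.succ))).1 = P.δL • (p * wordI f U * p) := by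
    unfold wordI wordJ
    rw [oddProd_succ, ← hE]
    by_cases h : Odd (n + 1)
    · have h' : ¬ Odd (n + 1 + 1) := by grind
      simp only [h, h', if_true, if_false, corner_val_mul, corner_val_smul, eE.1, toCorner_val]
      rw [smul_mul_assoc, sand_mul hp.eq eE.2]
    · have h' : Odd (n + 1 + 1) := by grind
      simp only [h, h', if_true, if_false, corner_val_mul, corner_val_smul, eE.1, vf, toCorner_val]
      rw [smul_mul_assoc, smul_mul_assoc, sand_mul hp.eq eE.2, sand_mul hp.eq cf]
  obtain ⟨k1, k2⟩ := localise_pair (p := p) hP (H _ _ .I_J_I) (H _ _ .J_I_J) hJp.1 hJp.2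
  intro x y h
  apply Subtype.ext
  cases h with
  | U_sq i =>
    simp only [corner_val_mul, corner_val_smul, vU, mul4 hp.eq (cU _), H _ _ (.U_sq i.succ),
      mul_smul_comm, Params.left]
  | U_braid i j h =>
    have := H _ _ (.U_braid i.succ j.succ (by simpa using h))
    simp only [corner_val_mul, vU, mul4 hp.eq (cU _)]
    rw [mul4 hp.eq (comm_mul (cU _) (cU _)), this]
  | U_comm i j h =>
    have := H _ _ (.U_comm i.succ j.succ (by simpa using h))
    simp only [corner_val_mul, vU, mul4 hp.eq (cU _), this]
  | e_sq =>
    simp only [corner_val_mul, corner_val_smul, toCorner_val, smul_mul_assoc, mul_smul_comm]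
    have : p * U 0 * p * (p * U 0 * p) = p * (U 0 * p * U 0) * p := by
      simp only [← mul_assoc]; rw [mul_assoc _ p p, hp.eq]
    rw [this, UpU]
    simp only [smul_mul_assoc, mul_smul_comm, smul_smul, Params.left]
    congr 1; field_simp
  | f_sq =>
    simp only [corner_val_mul, corner_val_smul, vf, mul4 hp.eq cf, H _ _ .f_sq,
      mul_smul_comm, Params.left]
  | U_e_U i h =>
    have := H _ _ (.U_braid i.succ 0 (by simp [h]))
    simp only [corner_val_mul, corner_val_smul, vU, toCorner_val, smul_mul_assoc, mul_smul_comm,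
      Params.left]
    congr 1
    rw [mul_sand hp.eq (cU _), sand_mul hp.eq (cU _), this, sand_comm hp.eq (cU _)]
  | U_f_U i h =>
    have := H _ _ (.U_f_U i.succ (by simpa using h))
    simp only [corner_val_mul, corner_val_smul, vU, vf, mul4 hp.eq (cU _)]
    rw [mul4 hp.eq (comm_mul (cU _) cf), this]
    simp [Params.left]
  | e_U i h =>
    have := H _ _ (.U_comm 0 i.succ (by simp; omega))
    simp only [corner_val_mul, corner_val_smul, vU, toCorner_val, smul_mul_assoc, mul_smul_comm]
    congr 1
    rw [mul_sand hp.eq (cU _), sand_mul hp.eq (cU _), this]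
  | f_U i h =>
    have := H _ _ (.f_U i.succ (by simpa using h))
    simp only [corner_val_mul, vU, vf, mul4 hp.eq (cU _), mul4 hp.eq cf, this]
  | e_f h =>
    have := H _ _ (.f_U 0 (by simp; omega))
    simp only [corner_val_mul, corner_val_smul, vf, toCorner_val, smul_mul_assoc, mul_smul_comm]
    congr 1
    rw [mul_sand hp.eq cf, sand_mul hp.eq cf, this]
  | I_J_I => simp only [corner_val_mul, corner_val_smul, wI, wJ]; exact k1
  | J_I_J => simp only [corner_val_mul, corner_val_smul, wI, wJ]; exact k2

theorem satisfies_right_aux (hP : P.δR ≠ 0) (H : Satisfies P e f U) (hp : IsIdempotentElem p)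
    (he' : f = P.δR • p)
    (ce : p * e = e * p)
    (ve : (toCorner hp e).1 = p * e)
    (eO : (oddProd fun i : Fin n => toCorner hp (U i.castSucc)).1 =
        p * oddProd (fun i : Fin n => U i.castSucc) ∧
      p * oddProd (fun i : Fin n => U i.castSucc) = oddProd (fun i : Fin n => U i.castSucc) * p)
    (eE : (evenProd fun i : Fin n => toCorner hp (U i.castSucc)).1 =
        p * evenProd (fun i : Fin n => U i.castSucc) ∧
      p * evenProd (fun i : Fin n => U i.castSucc) = evenProd (fun i : Fin n => U i.castSucc) * p)
    (X Y : hp.Corner)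
    (hX : X = wordI (P.δR • toCorner hp (U (Fin.last n)))
      (fun i : Fin n => toCorner hp (U i.castSucc)))
    (hY : Y = wordJ (toCorner hp e) (P.δR • toCorner hp (U (Fin.last n)))
      (fun i : Fin n => toCorner hp (U i.castSucc))) :
    (X * Y * X).1 = P.κ • X.1 ∧ (Y * X * Y).1 = P.κ • Y.1 := by
  have HI := H _ _ .I_J_I
  have HJ := H _ _ .J_I_J
  set O := oddProd (fun i : Fin n => U i.castSucc) with hO
  set E := evenProd (fun i : Fin n => U i.castSucc) with hE
  simp only [corner_val_mul]
  by_cases h : n % 2 = 0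
  · have h1 : Odd (n + 1) := by grind
    have h2 : ¬ Odd (n + 1 + 1) := by grind
    have h3 : ¬ n % 2 = 1 := by omega
    have vX : X.1 = P.δR • (p * wordI f U * p) := by
      simp only [hX, wordI, h1, h2, if_true, if_false, oddProd_castSucc, h, ← hO, corner_val_mul,
        corner_val_smul, eO.1, toCorner_val, mul_smul_comm]
      rw [mul_sand hp.eq eO.2]
    have vY : Y.1 = P.δR⁻¹ • wordJ e f U := by
      simp only [hY, wordJ, h1, h2, if_true, if_false, evenProd_castSucc, h3, ← hE, corner_val_mul,
        ve, eE.1, mul_one]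
      rw [mul4 hp.eq ce, he', mul_smul_comm, smul_smul, inv_mul_cancel₀ hP, one_smul,
        comm_mul ce eE.2]
    have hJ : p * wordJ e f U = wordJ e f U ∧ wordJ e f U * p = wordJ e f U := by
      simp only [wordJ, h2, if_false, evenProd_castSucc, h3, ← hE, mul_one, he', mul_smul_comm,
        smul_mul_assoc, mul_assoc, hp.eq, and_true]
      rw [← eE.2, ← mul_assoc e p E, ← ce, ← mul_assoc p, ← mul_assoc p, hp.eq]
    obtain ⟨k1, k2⟩ := localise_pair (p := p) hP HI HJ hJ.1 hJ.2
    rw [vX, vY]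
    exact ⟨k2, k1⟩
  · have h1 : ¬ Odd (n + 1) := by grind
    have h2 : Odd (n + 1 + 1) := by grind
    have h3 : n % 2 = 1 := by omega
    have vX : X.1 = P.δR⁻¹ • wordI f U := by
      simp only [hX, wordI, h1, h2, if_true, if_false, oddProd_castSucc, h, ← hO, eO.1, mul_one]
      rw [he', mul_smul_comm, smul_smul, inv_mul_cancel₀ hP, one_smul, eO.2]
    have vY : Y.1 = P.δR • (p * wordJ e f U * p) := by
      simp only [hY, wordJ, h1, h2, if_true, if_false, evenProd_castSucc, h3, ← hE, corner_val_mul,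
        corner_val_smul, ve, eE.1, toCorner_val, mul_smul_comm]
      rw [mul4 hp.eq ce, mul_sand hp.eq (comm_mul ce eE.2)]
      simp only [mul_assoc]
    have hJ : p * wordI f U = wordI f U ∧ wordI f U * p = wordI f U := by
      simp only [wordI, h2, if_true, oddProd_castSucc, h, if_false, ← hO, mul_one, he', mul_smul_comm,
        smul_mul_assoc, mul_assoc, hp.eq, and_true]
      rw [← eO.2, ← mul_assoc, hp.eq]
    obtain ⟨k1, k2⟩ := localise_pair (p := p) hP HJ HI hJ.1 hJ.2
    rw [vX, vY]
    exact ⟨k1, k2⟩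

theorem satisfies_right (hP : P.δR ≠ 0) (H : Satisfies P e f U) (hp : IsIdempotentElem p)
    (he : p = P.δR⁻¹ • f) :
    Satisfies P.right (toCorner hp e) (P.δR • toCorner hp (U (Fin.last n)))
      (fun i : Fin n => toCorner hp (U i.castSucc)) := by
  have cU : ∀ i : Fin n, p * U i.castSucc = U i.castSucc * p := fun i => by
    have := H _ _ (.f_U i.castSucc (by simp; omega))
    simp [he, this]
  have ce : p * e = e * p := by
    by_cases hn : 1 < n + 1 + 1
    · simp [he, H _ _ (.e_f hn)]
    · omega
  have vU : ∀ i : Fin n, (toCorner hp (U i.castSucc)).1 = p * U i.castSucc :=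
    fun i => toCorner_val' hp (cU i)
  have ve : (toCorner hp e).1 = p * e := toCorner_val' hp ce
  have UpU : U (Fin.last n) * p * U (Fin.last n) = (P.δR⁻¹ * P.κR) • U (Fin.last n) := by
    have := H _ _ (.U_f_U (Fin.last n) rfl)
    simp [he, this, smul_smul]
  have eO := corner_list_prod hp ((List.finRange n).filter fun i => i.val % 2 = 0)
    (fun i => U i.castSucc) (fun i => toCorner hp (U i.castSucc)) fun i _ => ⟨vU i, cU i⟩
  have eE := corner_list_prod hp ((List.finRange n).filter fun i => i.val % 2 = 1)
    (fun i => U i.castSucc) (fun i => toCorner hp (U i.castSucc)) fun i _ => ⟨vU i, cU i⟩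
  change (oddProd fun i : Fin n => toCorner hp (U i.castSucc)).1 =
    p * oddProd (fun i : Fin n => U i.castSucc)
    ∧ p * oddProd (fun i : Fin n => U i.castSucc) =
      oddProd (fun i : Fin n => U i.castSucc) * p at eO
  change (evenProd fun i : Fin n => toCorner hp (U i.castSucc)).1 =
    p * evenProd (fun i : Fin n => U i.castSucc)
    ∧ p * evenProd (fun i : Fin n => U i.castSucc) =
      evenProd (fun i : Fin n => U i.castSucc) * p at eE
  have he' : f = P.δR • p := by rw [he, smul_smul, mul_inv_cancel₀ hP, one_smul]
  set O := oddProd (fun i : Fin n => U i.castSucc) with hO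
  set E := evenProd (fun i : Fin n => U i.castSucc) with hE
  intro x y h
  apply Subtype.ext
  cases h with
  | U_sq i =>
    simp only [corner_val_mul, corner_val_smul, vU, mul4 hp.eq (cU _), H _ _ (.U_sq i.castSucc),
      mul_smul_comm, Params.right]
  | U_braid i j h =>
    have := H _ _ (.U_braid i.castSucc j.castSucc (by simpa using h))
    simp only [corner_val_mul, vU, mul4 hp.eq (cU _)]
    rw [mul4 hp.eq (comm_mul (cU _) (cU _)), this]
  | U_comm i j h =>
    have := H _ _ (.U_comm i.castSucc j.castSucc (by simpa using h))
    simp only [corner_val_mul, vU, mul4 hp.eq (cU _), this]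
  | f_sq =>
    simp only [corner_val_mul, corner_val_smul, toCorner_val, smul_mul_assoc, mul_smul_comm]
    have : p * U (Fin.last n) * p * (p * U (Fin.last n) * p) =
        p * (U (Fin.last n) * p * U (Fin.last n)) * p := by
      simp only [← mul_assoc]; rw [mul_assoc _ p p, hp.eq]
    rw [this, UpU]
    simp only [smul_mul_assoc, mul_smul_comm, smul_smul, Params.right]
    congr 1; field_simp
  | e_sq =>
    simp only [corner_val_mul, corner_val_smul, ve, mul4 hp.eq ce, H _ _ .e_sq,
      mul_smul_comm, Params.right]
  | U_f_U i h =>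
    have := H _ _ (.U_braid i.castSucc (Fin.last n) (by simp [h]))
    simp only [corner_val_mul, corner_val_smul, vU, toCorner_val, smul_mul_assoc, mul_smul_comm,
      Params.right]
    congr 1
    rw [mul_sand hp.eq (cU _), sand_mul hp.eq (cU _), this, sand_comm hp.eq (cU _)]
  | U_e_U i h =>
    have := H _ _ (.U_e_U i.castSucc (by simpa using h))
    simp only [corner_val_mul, corner_val_smul, vU, ve, mul4 hp.eq (cU _)]
    rw [mul4 hp.eq (comm_mul (cU _) ce), this]
    simp [Params.right]
  | f_U i h =>
    have := H _ _ (.U_comm (Fin.last n) i.castSucc (by simp; omega))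
    simp only [corner_val_mul, corner_val_smul, vU, toCorner_val, smul_mul_assoc, mul_smul_comm]
    congr 1
    rw [mul_sand hp.eq (cU _), sand_mul hp.eq (cU _), this]
  | e_U i h =>
    have := H _ _ (.e_U i.castSucc (by simpa using h))
    simp only [corner_val_mul, vU, ve, mul4 hp.eq (cU _), mul4 hp.eq ce, this]
  | e_f h =>
    have := H _ _ (.e_U (Fin.last n) (by simp; omega))
    simp only [corner_val_mul, corner_val_smul, ve, toCorner_val, smul_mul_assoc, mul_smul_comm]
    congr 1
    rw [mul_sand hp.eq ce, sand_mul hp.eq ce, this]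
  | I_J_I => exact (satisfies_right_aux hP H hp he' ce ve eO eE _ _ rfl rfl).1
  | J_I_J => exact (satisfies_right_aux hP H hp he' ce ve eO eE _ _ rfl rfl).2

end corner

section localisation

open CategoryTheory

universe v

variable {K : Type u} [Field K]

/-- The abelian group `p M = {p m | m ∈ M}`. -/
def Trunc {A : Type u} [Ring A] {p : A} (_ : IsIdempotentElem p) (M : Type v) [AddCommGroup M]
    [Module A M] : AddSubgroup M :=
  (DistribSMul.toAddMonoidHom M p).range

/-- `p M` is a module over the corner `p A p`, by restricting the action of `A`. -/
instance truncModule {A : Type u} [Ring A] {p : A} (hp : IsIdempotentElem p) (M : Type v)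
    [AddCommGroup M] [Module A M] : Module hp.Corner (Trunc hp M) where
  smul c m := ⟨c.1 • m.1, by
    obtain ⟨a, ha⟩ := c.2
    exact ⟨(a * p) • m.1, by simp [← ha, smul_smul, mul_assoc]⟩⟩
  one_smul m := Subtype.ext (by
    obtain ⟨m', hm'⟩ := m.2
    change p • m.1 = m.1
    rw [← hm']
    simp [smul_smul, hp.eq])
  mul_smul c d m := Subtype.ext (mul_smul c.1 d.1 m.1)
  smul_zero c := Subtype.ext (smul_zero c.1)
  smul_add c m m' := Subtype.ext (smul_add c.1 m.1 m'.1)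
  add_smul c d m := Subtype.ext (add_smul c.1 d.1 m.1)
  zero_smul m := Subtype.ext (zero_smul A m.1)

/-- The restriction of an `A`-linear map `M → N` to `p M → p N`. -/
def truncMap {A : Type u} [Ring A] {p : A} (hp : IsIdempotentElem p) {M N : Type v}
    [AddCommGroup M] [Module A M] [AddCommGroup N] [Module A N] (φ : M →ₗ[A] N) :
    Trunc hp M →ₗ[hp.Corner] Trunc hp N where
  toFun m := ⟨φ m.1, by
    obtain ⟨m', hm'⟩ := m.2
    exact ⟨φ m', by rw [← hm']; simp⟩⟩
  map_add' m m' := Subtype.ext (map_add φ m.1 m'.1)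
  map_smul' c m := Subtype.ext (map_smul φ c.1 m.1)

/-- The functor `M ↦ p M` from `A`-modules to `p A p`-modules. -/
def truncFunctor {A : Type u} [Ring A] {p : A} (hp : IsIdempotentElem p) :
    ModuleCat.{v} A ⥤ ModuleCat.{v} hp.Corner where
  obj M := ModuleCat.of hp.Corner (Trunc hp M)
  map φ := ModuleCat.ofHom (truncMap hp φ.hom)

/-- `ē = e / δ_L`. -/
def eBar (n : ℕ) (P : Params K) : Blob (n + 1) P := P.δL⁻¹ • Blob.gen P Gen.e

/-- `f̄ = f / δ_R`. -/
def fBar (n : ℕ) (P : Params K) : Blob (n + 1) P := P.δR⁻¹ • Blob.gen P Gen.f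

theorem eBar_idem (n : ℕ) {P : Params K} (h : P.δL ≠ 0) : IsIdempotentElem (eBar n P) := by
  have := Blob.satisfies (n := n) P _ _ .e_sq
  simp only [IsIdempotentElem, eBar, smul_mul_assoc, mul_smul_comm, this, smul_smul]
  congr 1; field_simp

theorem fBar_idem (n : ℕ) {P : Params K} (h : P.δR ≠ 0) : IsIdempotentElem (fBar n P) := by
  have := Blob.satisfies (n := n) P _ _ .f_sq
  simp only [IsIdempotentElem, fBar, smul_mul_assoc, mul_smul_comm, this, smul_smul]
  congr 1; field_simp

/-- The homomorphism `b'_n(Π_L) → ē b'_{n+1}(Π) ē` (inverse to the standard isomorphism):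
`1 ↦ ē`, `e ↦ δ_L ē U_1 ē = δ_L⁻¹ e U_1 e`, `U_i ↦ ē U_{i+1} ē`, `f ↦ ē f ē`. -/
def toCornerL {P : Params K} (h : P.δL ≠ 0) :
    (n : ℕ) → Blob n P.left →ₐ[K] (eBar_idem n h).Corner
  | 0 => Blob.lift₀ P.left
  | n + 1 => Blob.lift P.left
      (P.δL • toCorner (eBar_idem (n + 1) h) (Blob.gen P (Gen.U 0)))
      (toCorner (eBar_idem (n + 1) h) (Blob.gen P Gen.f))
      (fun i => toCorner (eBar_idem (n + 1) h) (Blob.gen P (Gen.U i.succ)))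
      (satisfies_left h (Blob.satisfies P) _ rfl)

/-- The homomorphism `b'_n(Π_R) → f̄ b'_{n+1}(Π) f̄` (inverse to the standard isomorphism):
`1 ↦ f̄`, `f ↦ δ_R f̄ U_n f̄ = δ_R⁻¹ f U_n f`, `U_i ↦ f̄ U_i f̄`, `e ↦ f̄ e f̄`. -/
def toCornerR {P : Params K} (h : P.δR ≠ 0) :
    (n : ℕ) → Blob n P.right →ₐ[K] (fBar_idem n h).Corner
  | 0 => Blob.lift₀ P.right
  | n + 1 => Blob.lift P.right
      (toCorner (fBar_idem (n + 1) h) (Blob.gen P Gen.e))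
      (P.δR • toCorner (fBar_idem (n + 1) h) (Blob.gen P (Gen.U (Fin.last n))))
      (fun i => toCorner (fBar_idem (n + 1) h) (Blob.gen P (Gen.U i.castSucc)))
      (satisfies_right h (Blob.satisfies P) _ rfl)

/-- The localisation functor `F_e : b'_{n+1}(Π)-mod → b'_n(Π_L)-mod`, `M ↦ ē M`. -/
noncomputable def locE (n : ℕ) {P : Params K} (h : P.δL ≠ 0) :
    ModuleCat.{v} (Blob (n + 1) P) ⥤ ModuleCat.{v} (Blob n P.left) :=
  truncFunctor (eBar_idem n h) ⋙ ModuleCat.restrictScalars (toCornerL h n).toRingHom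

/-- The localisation functor `F_f : b'_{n+1}(Π)-mod → b'_n(Π_R)-mod`, `M ↦ f̄ M`. -/
noncomputable def locF (n : ℕ) {P : Params K} (h : P.δR ≠ 0) :
    ModuleCat.{v} (Blob (n + 1) P) ⥤ ModuleCat.{v} (Blob n P.right) :=
  truncFunctor (fBar_idem n h) ⋙ ModuleCat.restrictScalars (toCornerR h n).toRingHom

end localisation

section tensor

/-- The eight weights `(a, b, c, d, x, y, z, w)`, all non-zero. -/
structure Weights (K : Type u) [Field K] where
  a : Kˣ
  b : Kˣ
  c : Kˣ
  d : Kˣ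
  x : Kˣ
  y : Kˣ
  z : Kˣ
  w : Kˣ

variable {K : Type u} [Field K]

/-- `Σ_L = (a, b, c, d, ab/x, cd/y, z, w)`. -/
def Weights.left (S : Weights K) : Weights K :=
  ⟨S.a, S.b, S.c, S.d, S.a * S.b / S.x, S.c * S.d / S.y, S.z, S.w⟩

/-- `Σ_R = (a, b, c, d, x, y, bc/z, ad/w)`. -/
def Weights.right (S : Weights K) : Weights K :=
  ⟨S.a, S.b, S.c, S.d, S.x, S.y, S.b * S.c / S.z, S.a * S.d / S.w⟩

/-- `q + 1/q`. -/
def quantumTwo (q : Kˣ) : K := (q : K) + ((q⁻¹ : Kˣ) : K)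

/-- The conditions on `Π` and `Σ` under which the tensor space carries the action of `b'_n(Π)`. -/
structure Compatible (n : ℕ) (S : Weights K) (P : Params K) : Prop where
  δ : P.δ = quantumTwo S.a * quantumTwo S.b * quantumTwo S.c * quantumTwo S.d
  δL : P.δL = quantumTwo S.x * quantumTwo S.y
  δR : P.δR = quantumTwo S.z * quantumTwo S.w
  κL : P.κL = quantumTwo (S.a * S.b / S.x) * quantumTwo (S.c * S.d / S.y)
  κR : P.κR = quantumTwo (S.a * S.d / S.w) * quantumTwo (S.b * S.c / S.z)
  κ_odd : Odd n → P.κ = quantumTwo (S.x * S.y / (S.z * S.w)) + 2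
  κ_even : Even n →
    P.κ = quantumTwo (S.a * S.b * S.c * S.d / (S.x * S.y * S.z * S.w)) + 2

theorem Compatible.left {n : ℕ} {S : Weights K} {P : Params K} (h : Compatible (n + 1) S P) :
    Compatible n S.left P.left where
  δ := h.δ
  δL := h.κL
  δR := h.δR
  κL := by
    simp only [Params.left, Weights.left, h.δL]; congr 2 <;> simp
  κR := h.κR
  κ_odd hn := by
    simp only [Params.left, Weights.left, h.κ_even (by grind)]
    congr 2
    ext; simp only [Units.val_div_eq_div_val, Units.val_mul]; field_simp
  κ_even hn := by
    simp only [Params.left, Weights.left, h.κ_odd (by grind)]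
    congr 2
    ext; simp only [Units.val_div_eq_div_val, Units.val_mul]; field_simp

theorem Compatible.right {n : ℕ} {S : Weights K} {P : Params K} (h : Compatible (n + 1) S P) :
    Compatible n S.right P.right where
  δ := h.δ
  δL := h.δL
  δR := by
    simp only [Params.right, Weights.right, h.κR]; ring
  κL := h.κL
  κR := by
    simp only [Params.right, Weights.right, h.δR]; rw [mul_comm]; congr 2 <;> simp
  κ_odd hn := by
    simp only [Params.right, Weights.right, h.κ_even (by grind), quantumTwo]
    rw [add_comm (Units.val _)]
    congr 3 <;> 
    · ext; simp only [Units.val_div_eq_div_val, Units.val_mul, Units.val_inv_eq_inv_val]; field_simp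
  κ_even hn := by
    simp only [Params.right, Weights.right, h.κ_odd (by grind), quantumTwo]
    rw [add_comm (Units.val _)]
    congr 3 <;> 
    · ext; simp only [Units.val_div_eq_div_val, Units.val_mul, Units.val_inv_eq_inv_val]; field_simp

/-- For distinct positions `i`, `j` of words on `{1, 2}` (the letters `1` and `2` are `0` and `1`
of `Fin 2`), the operator on the span of all words that sends a word `α` to
`q ^ (2 - α_i) α[i ↦ 1, j ↦ 2] + q ^ (1 - α_i) α[i ↦ 2, j ↦ 1]` if `α_i ≠ α_j` and to `0`
otherwise. -/
noncomputable def pairOp {X : Type*} [DecidableEq X] (q : Kˣ) (i j : X) :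
    Module.End K ((X → Fin 2) →₀ K) :=
  Finsupp.lsum K fun α : X → Fin 2 =>
    LinearMap.toSpanSingleton K _
      (if α i = α j then 0 else
        ((q ^ (1 - (α i : ℤ)) : Kˣ) : K) •
            Finsupp.single (Function.update (Function.update α i 0) j 1) 1 +
          ((q ^ (-(α i : ℤ)) : Kˣ) : K) •
            Finsupp.single (Function.update (Function.update α i 1) j 0) 1)

/-- The tensor positions `I_n = {-2n+1, …, 2n}`. -/
abbrev Site (n : ℕ) : Type := {i : ℤ // i ∈ Finset.Icc (-2 * (n : ℤ) + 1) (2 * n)}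

/-- The cyclic successor on `I_n`. -/
def Site.next {n : ℕ} (i : Site n) : Site n :=
  if h : i.1 = 2 * n then ⟨-2 * n + 1, by have := i.2; rw [Finset.mem_Icc] at *; omega⟩
  else ⟨i.1 + 1, by have := i.2; rw [Finset.mem_Icc] at *; omega⟩

/-- Words of length `4n` in two letters; they label the basis of `V_2^{⊗ 4n}`. -/
abbrev Word (n : ℕ) : Type := Site n → Fin 2

/-- The operator `R^q_i` on `V_2^{⊗ 4n}`, for an integer `i ∈ I_n`. -/
noncomputable def R (n : ℕ) (q : Kˣ) (i : ℤ)
    (h : i ∈ Finset.Icc (-2 * (n : ℤ) + 1) (2 * n) := by rw [Finset.mem_Icc]; omega) :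
    Module.End K (Word n →₀ K) :=
  pairOp q ⟨i, h⟩ (Site.next ⟨i, h⟩)

/-- The operator of `e` on `V_2^{⊗ 4n}`, `n = m + 1`. -/
noncomputable def opE (m : ℕ) (S : Weights K) : Module.End K (Word (m + 1) →₀ K) :=
  R (m + 1) S.x (-(m + 1)) * R (m + 1) S.y (m + 1)

/-- The operator of `f` on `V_2^{⊗ 4n}`, `n = m + 1`. -/
noncomputable def opF (m : ℕ) (S : Weights K) : Module.End K (Word (m + 1) →₀ K) :=
  R (m + 1) S.z 0 * R (m + 1) S.w (2 * (m + 1))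

/-- The operator of `U_{i+1}` on `V_2^{⊗ 4n}`, `n = m + 1`. -/
noncomputable def opU (m : ℕ) (S : Weights K) (i : Fin m) : Module.End K (Word (m + 1) →₀ K) :=
  R (m + 1) S.a (-(m + 1) - (i + 1)) * R (m + 1) S.b (-(m + 1) + (i + 1)) *
    R (m + 1) S.c ((m + 1) - (i + 1)) * R (m + 1) S.d ((m + 1) + (i + 1))

end tensor

section relations

set_option linter.unusedSimpArgs false

variable {K : Type u} [Field K]

/-- The weight of a pair of letters: `q` for `12`, `1` for `21`, and `0` for equal letters. -/
def wt (q : Kˣ) (s t : Fin 2) : K := if s = t then 0 else if s = 0 then (q : K) else 1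

@[simp] theorem wt_01 (q : Kˣ) : wt q 0 1 = (q : K) := by simp [wt]
@[simp] theorem wt_10 (q : Kˣ) : wt q 1 0 = (1 : K) := by simp [wt]
@[simp] theorem wt_self (q : Kˣ) (s : Fin 2) : wt q s s = (0 : K) := by simp [wt]

variable {X : Type*} [DecidableEq X]

theorem pairOp_single (q : Kˣ) (i j : X) (α : X → Fin 2) (r : K) :
    pairOp q i j (Finsupp.single α r) = (r * (q : K)⁻¹ * wt q (α i) (α j)) •
      ((q : K) • Finsupp.single (Function.update (Function.update α i 0) j 1) 1 +
        Finsupp.single (Function.update (Function.update α i 1) j 0) 1) := by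
  have h2 : ∀ t : Fin 2, t = 0 ∨ t = 1 := by decide
  simp only [pairOp, Finsupp.lsum_single, LinearMap.toSpanSingleton_apply]
  rcases h2 (α i) with h | h <;> rcases h2 (α j) with h' | h' <;>
    simp [h, h', smul_smul]

theorem pairOp_apply {i j : X} (hij : i ≠ j) (q : Kˣ) (ψ : (X → Fin 2) →₀ K) (β : X → Fin 2) :
    pairOp q i j ψ β = (q : K)⁻¹ * wt q (β i) (β j) *
      ((q : K) * ψ (Function.update (Function.update β i 0) j 1) +
        ψ (Function.update (Function.update β i 1) j 0)) := by
  classical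
  induction ψ using Finsupp.induction_linear with
  | zero => simp
  | add f g hf hg => simp only [map_add, Finsupp.add_apply, hf, hg]; ring
  | single α r =>
    have key : ∀ (α β : X → Fin 2) (s t : Fin 2),
        Function.update (Function.update α i s) j t = β ↔
          (β i = s ∧ β j = t) ∧ ∀ x, x ≠ i → x ≠ j → α x = β x := by
      intro α β s t
      constructor
      · rintro rfl
        refine ⟨⟨by simp [hij], by simp⟩, fun x h1 h2 => by simp [h1, h2]⟩
      · rintro ⟨⟨h1, h2⟩, h3⟩
        funext x
        by_cases hx : x = j
        · subst hx; simp [h2]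
        · by_cases hx' : x = i
          · subst hx'; simp [hx, h1]
          · simp [hx, hx', h3 x hx' hx]
    have key' : ∀ (α β : X → Fin 2) (s t : Fin 2),
        α = Function.update (Function.update β i s) j t ↔
          (α i = s ∧ α j = t) ∧ ∀ x, x ≠ i → x ≠ j → α x = β x := by
      intro α β s t
      rw [eq_comm, key]
      simp only [eq_comm]
    have h2 : ∀ t : Fin 2, t = 0 ∨ t = 1 := by decide
    rw [pairOp_single]
    simp only [Finsupp.smul_apply, Finsupp.add_apply, Finsupp.single_apply, key, key', smul_eq_mul]
    by_cases H : ∀ x, x ≠ i → x ≠ j → α x = β x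
    · rcases h2 (α i) with h | h <;> rcases h2 (α j) with h' | h' <;>
      rcases h2 (β i) with g | g <;> rcases h2 (β j) with g' | g' <;>
        simp [H, h, h', g, g', wt, mul_comm]
    · simp [H]

theorem pairOp_sq {i j : X} (hij : i ≠ j) (q : Kˣ) :
    pairOp q i j * pairOp q i j = quantumTwo q • (pairOp q i j : Module.End K _) := by
  apply LinearMap.ext; intro ψ; ext β
  simp only [Module.End.mul_apply, LinearMap.smul_apply, Finsupp.smul_apply, pairOp_apply hij,
    Function.update_comm hij, Function.update_idem, Function.update_self, smul_eq_mul,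
    Function.update_of_ne hij, Function.update_of_ne hij.symm, wt_01, wt_10, quantumTwo,
    Units.val_inv_eq_inv_val]
  field_simp

theorem pairOp_comm {i j k l : X} (hij : i ≠ j) (hik : i ≠ k) (hil : i ≠ l) (hjk : j ≠ k)
    (hjl : j ≠ l) (hkl : k ≠ l) (p q : Kˣ) :
    Commute (pairOp p i j) (pairOp q k l : Module.End K _) := by
  apply LinearMap.ext; intro ψ; ext β
  simp only [Module.End.mul_apply, pairOp_apply hij, pairOp_apply hkl,
    Function.update_comm hij, Function.update_comm hik, Function.update_comm hil,
    Function.update_comm hjk, Function.update_comm hjl, Function.update_comm hkl,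
    Function.update_idem, Function.update_self,
    Function.update_of_ne hij, Function.update_of_ne hij.symm,
    Function.update_of_ne hik, Function.update_of_ne hik.symm,
    Function.update_of_ne hil, Function.update_of_ne hil.symm,
    Function.update_of_ne hjk, Function.update_of_ne hjk.symm,
    Function.update_of_ne hjl, Function.update_of_ne hjl.symm,
    Function.update_of_ne hkl, Function.update_of_ne hkl.symm]
  ring

theorem pairOp_braid {i j k : X} (hij : i ≠ j) (hik : i ≠ k) (hjk : j ≠ k) (q : Kˣ) :
    pairOp q i j * pairOp q j k * pairOp q i j = (pairOp q i j : Module.End K _) := by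
  apply LinearMap.ext; intro ψ; ext β
  have h2 : ∀ t : Fin 2, t = 0 ∨ t = 1 := by decide
  simp only [Module.End.mul_apply, pairOp_apply hij, pairOp_apply hjk,
    Function.update_comm hij, Function.update_comm hik, 
    Function.update_comm hjk,
    Function.update_idem, Function.update_self,
    Function.update_of_ne hij, Function.update_of_ne hij.symm,
    Function.update_of_ne hik, Function.update_of_ne hik.symm,
    Function.update_of_ne hjk, Function.update_of_ne hjk.symm]
  rcases h2 (β k) with h | h <;>
  · have e : ∀ f : X → Fin 2, f k = β k → Function.update f k (β k) = f := fun f hf => by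
      rw [← hf, Function.update_eq_self]
    rw [h] at e
    simp [h]
    rw [e β h]; exact Or.inl rfl

theorem pairOp_braid' {i j k : X} (hij : i ≠ j) (hik : i ≠ k) (hjk : j ≠ k) (q : Kˣ) :
    pairOp q j k * pairOp q i j * pairOp q j k = (pairOp q j k : Module.End K _) := by
  apply LinearMap.ext; intro ψ; ext β
  have h2 : ∀ t : Fin 2, t = 0 ∨ t = 1 := by decide
  simp only [Module.End.mul_apply, pairOp_apply hij, pairOp_apply hjk,
    Function.update_comm hij.symm, Function.update_comm hik.symm, 
    Function.update_comm hjk.symm,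
    Function.update_idem, Function.update_self,
    Function.update_of_ne hij, Function.update_of_ne hij.symm,
    Function.update_of_ne hik, Function.update_of_ne hik.symm,
    Function.update_of_ne hjk, Function.update_of_ne hjk.symm]
  rcases h2 (β i) with h | h <;>
  · have e : ∀ f : X → Fin 2, f i = β i → Function.update f i (β i) = f := fun f hf => by
      rw [← hf, Function.update_eq_self]
    rw [h] at e
    simp [h]
    rw [e β h]; exact Or.inl rfl

theorem pairOp_bridge {i j k l : X} (hij : i ≠ j) (hik : i ≠ k) (hil : i ≠ l) (hjk : j ≠ k)
    (hjl : j ≠ l) (hkl : k ≠ l) (p q r : Kˣ) :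
    (pairOp p i j * pairOp q k l) * pairOp r j k * (pairOp p i j * pairOp q k l) =
      quantumTwo (p * q / r) • (pairOp p i j * pairOp q k l : Module.End K _) := by
  apply LinearMap.ext; intro ψ; ext β
  simp only [Module.End.mul_apply, LinearMap.smul_apply, Finsupp.smul_apply, pairOp_apply hij,
    pairOp_apply hkl, pairOp_apply hjk,
    Function.update_comm hij, Function.update_comm hik, Function.update_comm hil,
    Function.update_comm hjk, Function.update_comm hjl, Function.update_comm hkl,
    Function.update_idem, Function.update_self,
    Function.update_of_ne hij, Function.update_of_ne hij.symm,
    Function.update_of_ne hik, Function.update_of_ne hik.symm,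
    Function.update_of_ne hil, Function.update_of_ne hil.symm,
    Function.update_of_ne hjk, Function.update_of_ne hjk.symm,
    Function.update_of_ne hjl, Function.update_of_ne hjl.symm,
    Function.update_of_ne hkl, Function.update_of_ne hkl.symm, wt_01, wt_10, wt_self, quantumTwo,
    Units.val_inv_eq_inv_val, Units.val_div_eq_div_val, Units.val_mul, smul_eq_mul]
  field_simp
  ring


theorem Site.next_val {n : ℕ} (i : Site n) :
    i.next.1 = if i.1 = 2 * n then -2 * (n : ℤ) + 1 else i.1 + 1 := by
  unfold Site.next; split_ifs <;> rfl

/-- Two positions on the cycle `I_n` whose `R`-operators act on disjoint pairs of factors. -/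
def Far (n : ℕ) (s t : ℤ) : Prop :=
  s ≠ t ∧ s + 1 ≠ t ∧ t + 1 ≠ s ∧ ¬ (s = 2 * n ∧ t = -2 * n + 1) ∧ ¬ (t = 2 * n ∧ s = -2 * n + 1)

theorem Site.ne_next {n : ℕ} (_hn : 0 < n) (i : Site n) : i ≠ i.next := by
  intro h
  have h1 := congrArg Subtype.val h
  rw [Site.next_val] at h1
  split_ifs at h1 <;> omega

theorem Site.disjoint_of_far {n : ℕ} {s t : Site n} (h : Far n s.1 t.1) :
    s ≠ t ∧ s ≠ t.next ∧ s.next ≠ t ∧ s.next ≠ t.next := by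
  have hs := Finset.mem_Icc.1 s.2
  have ht := Finset.mem_Icc.1 t.2
  obtain ⟨h1, h2, h3, h4, h5⟩ := h
  refine ⟨fun h => h1 (congrArg Subtype.val h), ?_, ?_, ?_⟩ <;> intro h <;>
    replace h := congrArg Subtype.val h <;> simp only [Site.next_val] at h <;>
    split_ifs at h <;> omega

theorem R_comm {n : ℕ} (hn : 0 < n) (p q : Kˣ) {s t : ℤ} (hs ht) (h : Far n s t) :
    Commute (R n p s hs) (R n q t ht) := by
  obtain ⟨h1, h2, h3, h4⟩ := Site.disjoint_of_far (s := ⟨s, hs⟩) (t := ⟨t, ht⟩) h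
  exact pairOp_comm (Site.ne_next hn _) h1 h2 h3 h4 (Site.ne_next hn _) p q

theorem R_sq {n : ℕ} (hn : 0 < n) (q : Kˣ) {s : ℤ} (hs) :
    R n q s hs * R n q s hs = quantumTwo q • R n q s hs :=
  pairOp_sq (Site.ne_next hn _) q

theorem R_braid {n : ℕ} (hn : 0 < n) (q : Kˣ) {s t : ℤ} (hs ht) (h : s + 1 = t) :
    R n q s hs * R n q t ht * R n q s hs = R n q s hs := by
  subst h
  have ht' := Finset.mem_Icc.1 ht
  have hs' := Finset.mem_Icc.1 hs
  have e : Site.next ⟨s, hs⟩ = (⟨s + 1, ht⟩ : Site n) := by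
    apply Subtype.ext; rw [Site.next_val]; simp only; rw [if_neg (by omega)]
  unfold R
  rw [e]
  refine pairOp_braid (fun h => ?_) (fun h => ?_) (Site.ne_next hn _) q
  · have := congrArg Subtype.val h; simp at this
  · have := congrArg Subtype.val h; rw [Site.next_val] at this; simp only at this
    split_ifs at this <;> omega

theorem R_braid' {n : ℕ} (hn : 0 < n) (q : Kˣ) {s t : ℤ} (hs ht) (h : s + 1 = t) :
    R n q t ht * R n q s hs * R n q t ht = R n q t ht := by
  subst h
  have ht' := Finset.mem_Icc.1 ht
  have hs' := Finset.mem_Icc.1 hs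
  have e : Site.next ⟨s, hs⟩ = (⟨s + 1, ht⟩ : Site n) := by
    apply Subtype.ext; rw [Site.next_val]; simp only; rw [if_neg (by omega)]
  unfold R
  rw [e]
  refine pairOp_braid' (fun h => ?_) (fun h => ?_) (Site.ne_next hn _) q
  · have := congrArg Subtype.val h; simp at this
  · have := congrArg Subtype.val h; rw [Site.next_val] at this; simp only at this
    split_ifs at this <;> omega

/-- The relation for three consecutive positions `s`, `t`, `v` on the cycle. -/
theorem R_bridge {n : ℕ} (hn : 0 < n) (p q r : Kˣ) {s t v : ℤ} (hs ht hv)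
    (h : Far n s v) (h1 : t = if s = 2 * n then -2 * (n : ℤ) + 1 else s + 1)
    (h2 : v = if t = 2 * n then -2 * (n : ℤ) + 1 else t + 1) :
    (R n p s hs * R n q v hv) * R n r t ht * (R n p s hs * R n q v hv) =
      quantumTwo (p * q / r) • (R n p s hs * R n q v hv) := by
  have e1 : Site.next ⟨s, hs⟩ = (⟨t, ht⟩ : Site n) := by
    exact Subtype.ext ((Site.next_val _).trans h1.symm)
  have e2 : Site.next ⟨t, ht⟩ = (⟨v, hv⟩ : Site n) := by
    exact Subtype.ext ((Site.next_val _).trans h2.symm)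
  obtain ⟨d1, d2, d3, d4⟩ := Site.disjoint_of_far (s := ⟨s, hs⟩) (t := ⟨v, hv⟩) h
  unfold R
  rw [e1] at d3 d4 ⊢
  rw [e2]
  exact pairOp_bridge (e1 ▸ Site.ne_next hn _) d1 d2 d3 d4 (Site.ne_next hn _) p q r

/-- Four commuting strands: product formula used for all the local relations. -/
theorem four_mul {A : Type*} [Monoid A] {a b c d a' b' c' d' : A} (h1 : Commute b a')
    (h2 : Commute c a') (h3 : Commute d a') (h4 : Commute c b') (h5 : Commute d b')
    (h6 : Commute d c') : a * b * c * d * (a' * b' * c' * d') = a * a' * (b * b') * (c * c') * (d * d') := by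
  have e : a * b * c * d * (a' * b' * c' * d') = a * (b * (c * (d * a') * b') * c') * d' := by
    simp only [mul_assoc]
  rw [e, h3.eq, ← mul_assoc c, h2.eq]
  have e : a * (b * (a' * c * d * b') * c') * d' = a * (b * a') * (c * (d * b') * c') * d' := by
    simp only [mul_assoc]
  rw [e, h1.eq, h5.eq, ← mul_assoc c, h4.eq]
  have e : a * (a' * b) * (b' * c * d * c') * d' = a * (a' * b) * (b' * c * (d * c')) * d' := by
    simp only [mul_assoc]
  rw [e, h6.eq]
  simp only [mul_assoc]

theorem two_mul' {A : Type*} [Monoid A] {a b a' b' : A} (h1 : Commute b a') :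
    a * b * (a' * b') = a * a' * (b * b') := by
  rw [mul_assoc, ← mul_assoc b, h1.eq]; simp only [mul_assoc]

theorem two_mul3 {A : Type*} [Monoid A] {g h x y : A} (h1 : Commute h x) (h2 : Commute h g)
    (h3 : Commute y g) : g * h * (x * y) * (g * h) = g * x * g * (h * y * h) := by
  rw [two_mul' h1, two_mul' (Commute.mul_left h2 h3)]

theorem four_mul3 {A : Type*} [Monoid A] {a b c d a' b' c' d' : A} (h1 : Commute b a')
    (h2 : Commute c a') (h3 : Commute d a') (h4 : Commute c b') (h5 : Commute d b')
    (h6 : Commute d c') (k1 : Commute b' a)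
    (k2 : Commute c' a) (k3 : Commute d' a) (k4 : Commute c' b) (k5 : Commute d' b)
    (k6 : Commute d' c) (l1 : Commute b a)
    (l2 : Commute c a) (l3 : Commute d a) (l4 : Commute c b) (l5 : Commute d b)
    (l6 : Commute d c) : a * b * c * d * (a' * b' * c' * d') * (a * b * c * d) =
      a * a' * a * (b * b' * b) * (c * c' * c) * (d * d' * d) := by
  rw [four_mul h1 h2 h3 h4 h5 h6, four_mul (l1.mul_left k1) (l2.mul_left k2) (l3.mul_left k3)
    (l4.mul_left k4) (l5.mul_left k5) (l6.mul_left k6)]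

variable {m : ℕ} {S : Weights K} {P : Params K}

theorem opE_sq (h : Compatible (m + 1) S P) : opE m S * opE m S = P.δL • opE m S := by
  unfold opE
  rw [two_mul' (R_comm (by omega) _ _ _ _ (by unfold Far; push_cast; omega)), R_sq (by omega),
    R_sq (by omega), h.δL, smul_mul_smul_comm]

theorem opF_sq (h : Compatible (m + 1) S P) : opF m S * opF m S = P.δR • opF m S := by
  unfold opF
  rw [two_mul' (R_comm (by omega) _ _ _ _ (by unfold Far; push_cast; omega)), R_sq (by omega),
    R_sq (by omega), h.δR, smul_mul_smul_comm]

theorem opU_sq (h : Compatible (m + 1) S P) (i : Fin m) :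
    opU m S i * opU m S i = P.δ • opU m S i := by
  unfold opU
  have hi := i.2
  rw [four_mul]
  · simp only [R_sq (Nat.succ_pos m), smul_mul_smul_comm, h.δ]
  all_goals exact R_comm (by omega) _ _ _ _ (by unfold Far; push_cast; omega)

theorem opU_braid (i j : Fin m) (h : i.val + 1 = j.val ∨ j.val + 1 = i.val) :
    opU m S i * opU m S j * opU m S i = opU m S i := by
  unfold opU
  have hi := i.2
  have hj := j.2
  rw [four_mul3]
  · rcases h with h | h
    · rw [R_braid' (by omega) S.a _ _ (by omega), R_braid (by omega) S.b _ _ (by omega),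
        R_braid' (by omega) S.c _ _ (by omega), R_braid (by omega) S.d _ _ (by omega)]
    · rw [R_braid (by omega) S.a _ _ (by omega), R_braid' (by omega) S.b _ _ (by omega),
        R_braid (by omega) S.c _ _ (by omega), R_braid' (by omega) S.d _ _ (by omega)]
  all_goals exact R_comm (by omega) _ _ _ _ (by unfold Far; push_cast; omega)

theorem opU_comm (i j : Fin m) (h : ¬ (i.val + 1 = j.val ∨ j.val + 1 = i.val)) :
    Commute (opU m S i) (opU m S j) := by
  by_cases hij : i = j
  · subst hij; exact Commute.refl _
  have hij' : i.val ≠ j.val := fun h => hij (Fin.ext h)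
  have hi := i.2
  have hj := j.2
  unfold opU
  refine Commute.mul_left (Commute.mul_left (Commute.mul_left ?_ ?_) ?_) ?_ <;>
  refine Commute.mul_right (Commute.mul_right (Commute.mul_right ?_ ?_) ?_) ?_ <;>
  exact R_comm (by omega) _ _ _ _ (by unfold Far; push_cast; omega)

theorem opE_opU (i : Fin m) (h : i.val ≠ 0) : Commute (opE m S) (opU m S i) := by
  have hi := i.2
  unfold opU opE
  refine Commute.mul_left ?_ ?_ <;>
  refine Commute.mul_right (Commute.mul_right (Commute.mul_right ?_ ?_) ?_) ?_ <;>
  exact R_comm (by omega) _ _ _ _ (by unfold Far; push_cast; omega)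

theorem opF_opU (i : Fin m) (h : i.val + 1 ≠ m) : Commute (opF m S) (opU m S i) := by
  have hi := i.2
  unfold opU opF
  refine Commute.mul_left ?_ ?_ <;>
  refine Commute.mul_right (Commute.mul_right (Commute.mul_right ?_ ?_) ?_) ?_ <;>
  exact R_comm (by omega) _ _ _ _ (by unfold Far; push_cast; omega)

theorem opE_opF (h : 1 < m + 1) : Commute (opE m S) (opF m S) := by
  unfold opE opF
  refine Commute.mul_left ?_ ?_ <;>
  refine Commute.mul_right ?_ ?_ <;>
  exact R_comm (by omega) _ _ _ _ (by unfold Far; push_cast; omega)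

theorem opU_opE_opU (h : Compatible (m + 1) S P) (i : Fin m) (hi : i.val = 0) :
    opU m S i * opE m S * opU m S i = P.κL • opU m S i := by
  have him := i.2
  unfold opU opE
  rw [mul_assoc (_ * _) (R (m + 1) S.c _ _), two_mul3]
  · rw [R_bridge (by omega), R_bridge (by omega), h.κL, smul_mul_smul_comm]
    all_goals first
      | (unfold Far; push_cast; omega)
      | (rw [if_neg (by push_cast; omega)]; push_cast; omega)
  all_goals
    repeat' first | apply Commute.mul_left | apply Commute.mul_right
  all_goals exact R_comm (by omega) _ _ _ _ (by unfold Far; push_cast; omega)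

theorem opU_opF_opU (h : Compatible (m + 1) S P) (i : Fin m) (hi : i.val + 1 = m) :
    opU m S i * opF m S * opU m S i = P.κR • opU m S i := by
  have him := i.2
  have e : opU m S i = (R (m + 1) S.b (-(m + 1) + (i + 1)) * R (m + 1) S.c ((m + 1) - (i + 1))) *
      (R (m + 1) S.d ((m + 1) + (i + 1)) * R (m + 1) S.a (-(m + 1) - (i + 1))) := by
    unfold opU
    rw [mul_assoc, mul_assoc, ← mul_assoc (R (m + 1) S.b _ _), ← mul_assoc _ (R (m + 1) S.d _ _)]
    refine Commute.eq ?_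
    repeat' first | apply Commute.mul_left | apply Commute.mul_right
    all_goals exact R_comm (by omega) _ _ _ _ (by unfold Far; push_cast; omega)
  rw [e]
  unfold opF
  rw [two_mul3]
  · rw [R_bridge (by omega), R_bridge (by omega), h.κR, smul_mul_smul_comm, mul_comm S.d,
      mul_comm (quantumTwo (S.a * _ / _))]
    all_goals first
      | (unfold Far; push_cast; omega)
      | (rw [if_neg (by push_cast; omega)]; push_cast; omega)
      | (rw [if_pos (by push_cast; omega)]; push_cast; omega)
  all_goals
    repeat' first | apply Commute.mul_left | apply Commute.mul_right
  all_goals exact R_comm (by omega) _ _ _ _ (by unfold Far; push_cast; omega)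

/-- The weight attached to each position of the cycle. -/
def par (N : ℕ) (S : Weights K) (s : Site N) : Kˣ :=
  if s.1 = -N then S.x else if s.1 = N then S.y else if s.1 = 0 then S.z
  else if s.1 = 2 * N then S.w else if s.1 < -N then S.a else if s.1 < 0 then S.b
  else if s.1 < N then S.c else S.d

/-- The operator at a position, with its weight. -/
noncomputable def opAt (N : ℕ) (S : Weights K) (s : Site N) : Module.End K (Word N →₀ K) :=
  pairOp (par N S s) s s.next

/-- The weight of a word at a position. -/
def wtAt (N : ℕ) (S : Weights K) (s : Site N) (α : Word N) : K :=
  wt (par N S s) (α s) (α s.next)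

theorem wt_aux (q : Kˣ) (u v u' v' : Fin 2) (H : Prop) (r : K) [Decidable H]
    [Decidable ((u = 0 ∧ v = 1) ∧ H)] [Decidable ((u = 1 ∧ v = 0) ∧ H)] :
    (q : K)⁻¹ * wt q u' v' * ((q : K) * (if (u = 0 ∧ v = 1) ∧ H then r else 0) +
      (if (u = 1 ∧ v = 0) ∧ H then r else 0)) =
    if H then (q : K)⁻¹ * wt q u v * wt q u' v' * r else 0 := by
  have h2 : ∀ t : Fin 2, t = 0 ∨ t = 1 := by decide
  by_cases h : H
  · rcases h2 u with rfl | rfl <;> rcases h2 v with rfl | rfl <;> (simp [h]; try field_simp)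
  · simp [h]

theorem opAt_prod_single {N : ℕ} (hN : 0 < N) (S : Weights K) (L : List (Site N))
    (hL : L.Pairwise fun s t => Far N s.1 t.1) (α β : Word N) :
    (L.map (opAt N S)).prod (Finsupp.single α 1) β =
      open Classical in
      if ∀ s, (∀ t ∈ L, s ≠ t ∧ s ≠ t.next) → α s = β s then
        (L.map fun t => ((par N S t : K))⁻¹ * wtAt N S t α * wtAt N S t β).prod else 0 := by
  classical
  induction L generalizing β with
  | nil =>
    simp only [List.map_nil, List.prod_nil, Module.End.one_apply, Finsupp.single_apply]
    refine if_congr ?_ rfl rfl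
    simp [funext_iff]
  | cons t L ih =>
    rw [List.pairwise_cons] at hL
    obtain ⟨ht, hL⟩ := hL
    have hne := Site.ne_next hN t
    have h2 : ∀ t : Fin 2, t = 0 ∨ t = 1 := by decide
    have hd : ∀ t' ∈ L, t ≠ t' ∧ t ≠ t'.next ∧ t.next ≠ t' ∧ t.next ≠ t'.next := fun t' h' =>
      Site.disjoint_of_far (ht t' h')
    simp only [List.map_cons, List.prod_cons, Module.End.mul_apply]
    rw [opAt, pairOp_apply hne, ih hL, ih hL]
    have hprod : ∀ u v : Fin 2, (L.map fun t' => ((par N S t' : K))⁻¹ * wtAt N S t' α *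
        wtAt N S t' (Function.update (Function.update β t u) t.next v)) =
        L.map fun t' => ((par N S t' : K))⁻¹ * wtAt N S t' α * wtAt N S t' β := by
      intro u v
      refine List.map_congr_left fun t' h' => ?_
      obtain ⟨d1, d2, d3, d4⟩ := hd t' h'
      simp only [wtAt, Function.update_of_ne d1.symm, Function.update_of_ne d2.symm,
        Function.update_of_ne d3.symm, Function.update_of_ne d4.symm]
    have hcond : ∀ u v : Fin 2, (∀ s, (∀ t' ∈ L, s ≠ t' ∧ s ≠ t'.next) →
          α s = Function.update (Function.update β t u) t.next v s) ↔
        (α t = u ∧ α t.next = v) ∧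
          ∀ s, (∀ t' ∈ t :: L, s ≠ t' ∧ s ≠ t'.next) → α s = β s := by
      intro u v
      constructor
      · intro h
        refine ⟨⟨?_, ?_⟩, fun s hs => ?_⟩
        · have := h t fun t' h' => ⟨(hd t' h').1, (hd t' h').2.1⟩
          simpa [hne] using this
        · have := h t.next fun t' h' => ⟨(hd t' h').2.2.1, (hd t' h').2.2.2⟩
          simpa using this
        · have := h s fun t' h' => hs t' (List.mem_cons_of_mem _ h')
          obtain ⟨e1, e2⟩ := hs t List.mem_cons_self
          simpa [e1, e2] using this
      · rintro ⟨⟨h1, h3⟩, h⟩ s hs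
        by_cases e2 : s = t.next
        · subst e2; simp [h3]
        · by_cases e1 : s = t
          · subst e1; simp [hne, h1]
          · simp only [Function.update_of_ne e2, Function.update_of_ne e1]
            refine h s fun t' h' => ?_
            rcases List.mem_cons.1 h' with rfl | h'
            · exact ⟨e1, e2⟩
            · exact hs t' h'
    simp only [hprod, hcond]
    exact wt_aux _ _ _ _ _ _ _

/-- The vector `∏ wt` attached to a list of positions. -/
def bigWt {N : ℕ} (S : Weights K) (L : List (Site N)) (α : Word N) : K :=
  (L.map fun t => wtAt N S t α).prod

/-- The product of the weights of a list of positions. -/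
def bigPar {N : ℕ} (S : Weights K) (L : List (Site N)) : Kˣ := (L.map (par N S)).prod

theorem opAt_prod_apply {N : ℕ} (hN : 0 < N) (S : Weights K) (L : List (Site N))
    (hL : L.Pairwise fun s t => Far N s.1 t.1) (hc : ∀ s, ∃ t ∈ L, s = t ∨ s = t.next)
    (ψ : Word N →₀ K) (β : Word N) :
    (L.map (opAt N S)).prod ψ β =
      (bigPar S L : K)⁻¹ * bigWt S L β * ∑ α, bigWt S L α * ψ α := by
  classical
  have hp : ∀ α, (L.map fun t => ((par N S t : K))⁻¹ * wtAt N S t α * wtAt N S t β).prod =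
      (bigPar S L : K)⁻¹ * bigWt S L α * bigWt S L β := by
    intro α
    rw [List.prod_map_mul, List.prod_map_mul]
    congr 2
    unfold bigPar
    clear hL hc
    induction L with
    | nil => simp
    | cons a l ih => simp [ih, mul_comm]
  induction ψ using Finsupp.induction_linear with
  | zero => simp
  | add f g hf hg =>
    simp only [map_add, Finsupp.add_apply, hf, hg, mul_add, Finset.sum_add_distrib]
  | single α r =>
    have e : Finsupp.single α r = r • Finsupp.single α (1 : K) := by simp
    rw [e, map_smul, Finsupp.smul_apply, opAt_prod_single hN S L hL, if_pos, hp]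
    · rw [Finset.sum_eq_single α]
      · simp; ring
      · intro b _ hb; simp [Finsupp.single_apply, hb.symm]
      · simp
    · intro s hs
      obtain ⟨t, ht, h⟩ := hc s
      rcases h with h | h
      · exact absurd h (hs t ht).1
      · exact absurd h (hs t ht).2

/-- The alternating words on the cycle. -/
def altWord (N : ℕ) (c : ℤ) : Word N := fun s => if s.1 % 2 = c then 0 else 1

/-- Rank-one collapse for two lists of positions that cover the odd and the even positions. -/
theorem opAt_collapse {N : ℕ} (hN : 0 < N) (S : Weights K) (L L' : List (Site N)) (c c' : ℤ)
    (hcc : c = 0 ∧ c' = 1 ∨ c = 1 ∧ c' = 0)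
    (hL : L.Nodup) (hL' : L'.Nodup) (hm : ∀ s, s ∈ L ↔ s.1 % 2 = c)
    (hm' : ∀ s, s ∈ L' ↔ s.1 % 2 = c') :
    (L.map (opAt N S)).prod * (L'.map (opAt N S)).prod * (L.map (opAt N S)).prod =
      (quantumTwo (bigPar S L / bigPar S L') + 2) • (L.map (opAt N S)).prod := by
  classical
  have far : ∀ s t : Site N, s ≠ t → s.1 % 2 = t.1 % 2 → Far N s.1 t.1 := by
    intro s t h h'
    have : s.1 ≠ t.1 := fun e => h (Subtype.ext e)
    unfold Far; omega
  have pw : L.Pairwise fun s t => Far N s.1 t.1 :=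
    hL.pairwise_of_forall_ne fun s hs t ht h => far s t h (by rw [(hm s).1 hs, (hm t).1 ht])
  have pw' : L'.Pairwise fun s t => Far N s.1 t.1 :=
    hL'.pairwise_of_forall_ne fun s hs t ht h => far s t h (by rw [(hm' s).1 hs, (hm' t).1 ht])
  have cov : ∀ s : Site N, ∃ t : Site N, t.1 % 2 ≠ s.1 % 2 ∧ s = t.next := by
    intro s
    have hs := Finset.mem_Icc.1 s.2
    by_cases h : s.1 = -2 * N + 1
    · refine ⟨⟨2 * N, by rw [Finset.mem_Icc]; omega⟩, ?_, Subtype.ext ?_⟩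
      · simp only; omega
      · rw [Site.next_val]; simp [h]
    · refine ⟨⟨s.1 - 1, by rw [Finset.mem_Icc]; omega⟩, ?_, Subtype.ext ?_⟩
      · simp only; omega
      · rw [Site.next_val]; simp only; rw [if_neg (by omega)]; omega
  have hc : ∀ s, ∃ t ∈ L, s = t ∨ s = t.next := by
    intro s
    by_cases h : s.1 % 2 = c
    · exact ⟨s, (hm s).2 h, Or.inl rfl⟩
    · obtain ⟨t, h1, h2⟩ := cov s
      exact ⟨t, (hm t).2 (by omega), Or.inr h2⟩
  have hc' : ∀ s, ∃ t ∈ L', s = t ∨ s = t.next := by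
    intro s
    by_cases h : s.1 % 2 = c'
    · exact ⟨s, (hm' s).2 h, Or.inl rfl⟩
    · obtain ⟨t, h1, h2⟩ := cov s
      exact ⟨t, (hm' t).2 (by omega), Or.inr h2⟩
  have nextpar : ∀ s : Site N, s.next.1 % 2 ≠ s.1 % 2 := by
    intro s; rw [Site.next_val]; split_ifs <;> omega
  have same : ∀ (M : List (Site N)) (k : ℤ), (∀ s ∈ M, s.1 % 2 = k) →
      bigWt S M (altWord N k) = (bigPar S M : K) := by
    intro M k hM
    unfold bigWt bigPar
    rw [← Units.coeHom_apply, map_list_prod, List.map_map]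
    congr 1
    refine List.map_congr_left fun s hs => ?_
    have h1 := hM s hs
    have h2 : s.next.1 % 2 ≠ k := by rw [← h1]; exact nextpar s
    simp [wtAt, altWord, h1, h2]
  have diff : ∀ (M : List (Site N)) (k l : ℤ), (k = 0 ∧ l = 1 ∨ k = 1 ∧ l = 0) →
      (∀ s ∈ M, s.1 % 2 = k) → bigWt S M (altWord N l) = (1 : K) := by
    intro M k l hkl hM
    unfold bigWt
    refine List.prod_eq_one fun x hx => ?_
    obtain ⟨s, hs, rfl⟩ := List.mem_map.1 hx
    have h1 := hM s hs
    have h2 := nextpar s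
    have h3 : s.next.1 % 2 = l := by omega
    have h4 : s.1 % 2 ≠ l := by omega
    simp [wtAt, altWord, h3, h4]
  have alt : ∀ β : Word N, (∀ s, β s ≠ β s.next) → β = altWord N c ∨ β = altWord N c' := by
    intro β hβ
    have h2 : ∀ t : Fin 2, t = 0 ∨ t = 1 := by decide
    have key : ∀ (k : ℕ) (hk : -2 * (N : ℤ) + 1 + k ∈ Finset.Icc (-2 * (N : ℤ) + 1) (2 * N)),
        β ⟨-2 * (N : ℤ) + 1 + k, hk⟩ =
          if k % 2 = 0 then β ⟨-2 * (N : ℤ) + 1, by rw [Finset.mem_Icc]; omega⟩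
          else 1 - β ⟨-2 * (N : ℤ) + 1, by rw [Finset.mem_Icc]; omega⟩ := by
      intro k
      induction k with
      | zero => intro hk; simp
      | succ k ih =>
        intro hk
        have hk' := Finset.mem_Icc.1 hk
        push_cast at hk'
        have hk0 : -2 * (N : ℤ) + 1 + k ∈ Finset.Icc (-2 * (N : ℤ) + 1) (2 * N) := by
          rw [Finset.mem_Icc]; omega
        have e : (⟨-2 * (N : ℤ) + 1 + ((k + 1 : ℕ) : ℤ), hk⟩ : Site N) =
            Site.next ⟨-2 * (N : ℤ) + 1 + k, hk0⟩ := by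
          apply Subtype.ext; rw [Site.next_val]; simp only
          rw [if_neg (by omega)]; push_cast; ring
        have hne := hβ ⟨-2 * (N : ℤ) + 1 + k, hk0⟩
        have hdec : ∀ u v w : Fin 2, (u ≠ v → u = w → v = 1 - w) ∧ (u ≠ v → u = 1 - w → v = w) := by
          decide
        rw [← e, ih hk0] at hne
        by_cases hp : k % 2 = 0
        · have hp' : ¬ (k + 1) % 2 = 0 := by omega
          rw [if_pos hp] at hne
          rw [if_neg hp']
          exact (hdec _ _ _).1 hne rfl
        · have hp' : (k + 1) % 2 = 0 := by omega
          rw [if_neg hp] at hne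
          rw [if_pos hp']
          exact (hdec _ _ _).2 hne rfl
    have key' : ∀ s : Site N, β s = if s.1 % 2 = 1 then
        β ⟨-2 * (N : ℤ) + 1, by rw [Finset.mem_Icc]; omega⟩
          else 1 - β ⟨-2 * (N : ℤ) + 1, by rw [Finset.mem_Icc]; omega⟩ := by
      intro s
      have hs := Finset.mem_Icc.1 s.2
      have e : s.1 = -2 * (N : ℤ) + 1 + ((s.1 - (-2 * (N : ℤ) + 1)).toNat : ℤ) := by omega
      have e' : s = ⟨-2 * (N : ℤ) + 1 + ((s.1 - (-2 * (N : ℤ) + 1)).toNat : ℤ), e ▸ s.2⟩ :=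
        Subtype.ext e
      rw [congrArg β e', key]
      refine if_congr ?_ rfl rfl
      omega
    have both : β = altWord N 1 ∨ β = altWord N 0 := by
      rcases h2 (β ⟨-2 * (N : ℤ) + 1, by rw [Finset.mem_Icc]; omega⟩) with h | h
      · left; funext s; rw [key' s, h]; unfold altWord; split_ifs <;> simp
      · right; funext s; rw [key' s, h]; unfold altWord
        split_ifs <;> omega
    rcases hcc with ⟨rfl, rfl⟩ | ⟨rfl, rfl⟩ <;> tauto
  have altne : altWord N c ≠ altWord N c' := by
    intro h
    have := congrFun h ⟨1, by rw [Finset.mem_Icc]; omega⟩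
    rcases hcc with ⟨rfl, rfl⟩ | ⟨rfl, rfl⟩ <;> simp [altWord] at this
  have inner : ∑ β, bigWt S L β * bigWt S L' β = (bigPar S L : K) + (bigPar S L' : K) := by
    rw [Finset.sum_eq_add (altWord N c) (altWord N c') altne]
    · rw [same L c fun s hs => (hm s).1 hs, same L' c' fun s hs => (hm' s).1 hs,
        diff L c c' hcc fun s hs => (hm s).1 hs,
        diff L' c' c (by omega) fun s hs => (hm' s).1 hs]
      ring
    · intro β _ hβ
      by_contra hne
      have : ∀ s, β s ≠ β s.next := by
        intro s hs
        apply hne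
        by_cases h : s.1 % 2 = c
        · have : bigWt S L β = 0 := List.prod_eq_zero (List.mem_map.2
            ⟨s, (hm s).2 h, by simp [wtAt, hs]⟩)
          simp [this]
        · have : bigWt S L' β = 0 := List.prod_eq_zero (List.mem_map.2
            ⟨s, (hm' s).2 (by omega), by simp [wtAt, hs]⟩)
          simp [this]
      rcases alt β this with h | h
      · exact hβ.1 h
      · exact hβ.2 h
    · simp
    · simp
  have inner' : ∑ β, bigWt S L' β * bigWt S L β = (bigPar S L : K) + (bigPar S L' : K) := by
    rw [← inner]; exact Finset.sum_congr rfl fun _ _ => mul_comm _ _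
  have hL1 := opAt_prod_apply hN S L pw hc
  have hL2 := opAt_prod_apply hN S L' pw' hc'
  apply LinearMap.ext; intro ψ; ext β
  simp only [Module.End.mul_apply, LinearMap.smul_apply, Finsupp.smul_apply, hL1, hL2]
  have s1 : ∀ (g u v : Word N → K) (r t : K), ∑ α, g α * (r * u α * t) = r * t * ∑ α, g α * u α := by
    intro g u v r t
    rw [Finset.mul_sum]; exact Finset.sum_congr rfl fun _ _ => by ring
  rw [s1 _ _ (bigWt S L), s1 _ _ (bigWt S L), inner, inner']
  simp only [quantumTwo, Units.val_inv_eq_inv_val, Units.val_div_eq_div_val, smul_eq_mul]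
  have p1 := (bigPar S L).ne_zero
  have p2 := (bigPar S L').ne_zero
  field_simp
  ring

/-- The four positions of `U_{i+1}`. -/
def sitesU (m : ℕ) (i : Fin m) : List (Site (m + 1)) :=
  [⟨-(m + 1) - (i + 1), by rw [Finset.mem_Icc]; omega⟩,
    ⟨-(m + 1) + (i + 1), by rw [Finset.mem_Icc]; omega⟩,
    ⟨(m + 1) - (i + 1), by rw [Finset.mem_Icc]; omega⟩,
    ⟨(m + 1) + (i + 1), by rw [Finset.mem_Icc]; omega⟩]

def sitesE (m : ℕ) : List (Site (m + 1)) :=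
  [⟨-(m + 1), by rw [Finset.mem_Icc]; omega⟩, ⟨m + 1, by rw [Finset.mem_Icc]; omega⟩]

def sitesF (m : ℕ) : List (Site (m + 1)) :=
  [⟨0, by rw [Finset.mem_Icc]; omega⟩, ⟨2 * (m + 1), by rw [Finset.mem_Icc]; omega⟩]

theorem par_U (i : Fin m) : (sitesU m i).map (par (m + 1) S) = [S.a, S.b, S.c, S.d] := by
  have := i.2
  simp only [sitesU, List.map_cons, List.map_nil, par]
  congr 1
  · split_ifs <;> first | rfl | omega
  congr 1
  · split_ifs <;> first | rfl | omega
  congr 1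
  · split_ifs <;> first | rfl | omega
  congr 1
  · split_ifs <;> first | rfl | omega

theorem par_E : (sitesE m).map (par (m + 1) S) = [S.x, S.y] := by
  simp only [sitesE, List.map_cons, List.map_nil, par]
  congr 1
  · split_ifs <;> first | rfl | omega
  congr 1
  · split_ifs <;> first | rfl | omega

theorem par_F : (sitesF m).map (par (m + 1) S) = [S.z, S.w] := by
  simp only [sitesF, List.map_cons, List.map_nil, par]
  congr 1
  · split_ifs <;> first | rfl | omega

theorem opU_eq (i : Fin m) : opU m S i = ((sitesU m i).map (opAt (m + 1) S)).prod := by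
  have h := par_U (S := S) i
  simp only [sitesU, List.map_cons, List.map_nil, List.cons.injEq, and_true] at h
  obtain ⟨h1, h2, h3, h4⟩ := h
  simp only [sitesU, List.map_cons, List.map_nil, List.prod_cons, List.prod_nil, mul_one, opAt,
    h1, h2, h3, h4, opU, R, mul_assoc]

theorem opE_eq : opE m S = ((sitesE m).map (opAt (m + 1) S)).prod := by
  have h := par_E (S := S) (m := m)
  simp only [sitesE, List.map_cons, List.map_nil, List.cons.injEq, and_true] at h
  obtain ⟨h1, h2⟩ := h
  simp only [sitesE, List.map_cons, List.map_nil, List.prod_cons, List.prod_nil, mul_one, opAt,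
    h1, h2, opE, R]

theorem opF_eq : opF m S = ((sitesF m).map (opAt (m + 1) S)).prod := by
  have h := par_F (S := S) (m := m)
  simp only [sitesF, List.map_cons, List.map_nil, List.cons.injEq, and_true] at h
  obtain ⟨h1, h2⟩ := h
  simp only [sitesF, List.map_cons, List.map_nil, List.prod_cons, List.prod_nil, mul_one, opAt,
    h1, h2, opF, R]

/-- The positions of all `U_{i+1}` with `i ≡ c` modulo `2`. -/
def sitesUU (m c : ℕ) : List (Site (m + 1)) :=
  ((List.finRange m).filter fun i => i.val % 2 = c).flatMap (sitesU m)

theorem opUU_eq (c : ℕ) :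
    (((List.finRange m).filter fun i => i.val % 2 = c).map (opU m S)).prod =
      ((sitesUU m c).map (opAt (m + 1) S)).prod := by
  unfold sitesUU
  induction (List.finRange m).filter fun i => i.val % 2 = c with
  | nil => simp
  | cons a l ih => simp [ih, opU_eq]

theorem parUU_eq (c : ℕ) : bigPar S (sitesUU m c) =
    (S.a * S.b * S.c * S.d) ^ ((List.finRange m).filter fun i => i.val % 2 = c).length := by
  unfold sitesUU bigPar
  induction (List.finRange m).filter fun i => i.val % 2 = c with
  | nil => simp
  | cons a l ih =>
    rw [List.flatMap_cons, List.map_append, List.prod_append, ih, par_U]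
    simp [pow_succ', mul_assoc]

theorem length_filter (m : ℕ) :
    ((List.finRange m).filter fun i => i.val % 2 = 0).length = (m + 1) / 2 ∧
    ((List.finRange m).filter fun i => i.val % 2 = 1).length = m / 2 := by
  induction m with
  | zero => simp
  | succ m ih =>
    obtain ⟨h1, h2⟩ := ih
    rcases Nat.mod_two_eq_zero_or_one m with h | h
    · constructor
      · simp [List.finRange_succ_last, List.filter_map, Function.comp_def, h, h1]; omega
      · simp [List.finRange_succ_last, List.filter_map, Function.comp_def, h, h2]; omega
    · constructor
      · simp [List.finRange_succ_last, List.filter_map, Function.comp_def, h, h1]; omega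
      · simp [List.finRange_succ_last, List.filter_map, Function.comp_def, h, h2]; omega

theorem mem_sitesU (i : Fin m) (s : Site (m + 1)) : s ∈ sitesU m i ↔
    s.1 = -(m + 1) - (i + 1) ∨ s.1 = -(m + 1) + (i + 1) ∨ s.1 = (m + 1) - (i + 1) ∨
      s.1 = (m + 1) + (i + 1) := by
  simp [sitesU, Subtype.ext_iff]

theorem mem_sitesE (s : Site (m + 1)) : s ∈ sitesE m ↔ s.1 = -(m + 1) ∨ s.1 = m + 1 := by
  simp [sitesE, Subtype.ext_iff]

theorem mem_sitesF (s : Site (m + 1)) : s ∈ sitesF m ↔ s.1 = 0 ∨ s.1 = 2 * (m + 1) := by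
  simp [sitesF, Subtype.ext_iff]

theorem mem_sitesUU (c : ℕ) (s : Site (m + 1)) : s ∈ sitesUU m c ↔
    ∃ k : ℕ, k < m ∧ k % 2 = c ∧ (s.1 = -(m + 1) - (k + 1) ∨ s.1 = -(m + 1) + (k + 1) ∨
      s.1 = (m + 1) - (k + 1) ∨ s.1 = (m + 1) + (k + 1)) := by
  simp only [sitesUU, List.mem_flatMap, List.mem_filter, List.mem_finRange, true_and,
    decide_eq_true_eq, mem_sitesU]
  constructor
  · rintro ⟨i, h1, h2⟩; exact ⟨i, i.2, h1, h2⟩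
  · rintro ⟨k, h0, h1, h2⟩; exact ⟨⟨k, h0⟩, h1, h2⟩

theorem mem_sitesUU' (c : ℕ) (hc : c = 0 ∨ c = 1) (s : Site (m + 1)) : s ∈ sitesUU m c ↔
    s.1 % 2 = ((m + c : ℕ) : ℤ) % 2 ∧ s.1 ≠ 0 ∧ s.1 ≠ 2 * (m + 1) ∧ s.1 ≠ m + 1 ∧
      s.1 ≠ -(m + 1) := by
  rw [mem_sitesUU]
  have hs := Finset.mem_Icc.1 s.2
  push_cast at *
  constructor
  · rintro ⟨k, h0, h1, h2⟩
    rcases h2 with h2 | h2 | h2 | h2 <;> rw [h2] <;> omega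
  · rintro ⟨h1, h2, h3, h4, h5⟩
    rcases lt_or_ge s.1 (-(m + 1)) with h | h
    · exact ⟨(-(m + 1) - 1 - s.1).toNat, by omega, by omega, by omega⟩
    rcases lt_or_ge s.1 0 with h | h
    · exact ⟨((m + 1) - 1 + s.1).toNat, by omega, by omega, by omega⟩
    rcases lt_or_ge s.1 (m + 1) with h | h
    · exact ⟨((m + 1) - 1 - s.1).toNat, by omega, by omega, by omega⟩
    · exact ⟨(s.1 - (m + 1) - 1).toNat, by omega, by omega, by omega⟩

theorem nodup_sitesE : (sitesE m).Nodup := by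
  simp [sitesE]; omega

theorem nodup_sitesF : (sitesF m).Nodup := by
  simp [sitesF]; omega

theorem nodup_sitesUU (c : ℕ) : (sitesUU m c).Nodup := by
  rw [sitesUU, List.nodup_flatMap]
  constructor
  · intro i _
    have := i.2
    simp [sitesU]; omega
  · refine List.Nodup.pairwise_of_forall_ne ((List.nodup_finRange m).filter _) ?_
    intro i _ j _ hij s h1 h2
    have hij' : i.val ≠ j.val := fun h => hij (Fin.ext h)
    rw [mem_sitesU] at h1 h2
    have := i.2
    have := j.2
    omega

theorem disj {L L' : List (Site (m + 1))} (h : ∀ s, s ∈ L → s ∈ L' → False) : L.Disjoint L' :=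
  fun s h1 h2 => h s h1 h2

/-- The two long relations. -/
theorem op_long (h : Compatible (m + 1) S P) :
    wordI (opF m S) (opU m S) * wordJ (opE m S) (opF m S) (opU m S) * wordI (opF m S) (opU m S) =
      P.κ • wordI (opF m S) (opU m S) ∧
    wordJ (opE m S) (opF m S) (opU m S) * wordI (opF m S) (opU m S) *
      wordJ (opE m S) (opF m S) (opU m S) = P.κ • wordJ (opE m S) (opF m S) (opU m S) := by
  have hO : oddProd (opU m S) = ((sitesUU m 0).map (opAt (m + 1) S)).prod := opUU_eq 0
  have hE : evenProd (opU m S) = ((sitesUU m 1).map (opAt (m + 1) S)).prod := opUU_eq 1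
  have qinv : ∀ t : Kˣ, quantumTwo t⁻¹ = quantumTwo t := fun t => by
    simp [quantumTwo, add_comm]
  have hp0 := parUU_eq (S := S) (m := m) 0
  have hp1 := parUU_eq (S := S) (m := m) 1
  rw [(length_filter m).1] at hp0
  rw [(length_filter m).2] at hp1
  have pE : bigPar S (sitesE m) = S.x * S.y := by simp [bigPar, par_E]
  have pF : bigPar S (sitesF m) = S.z * S.w := by simp [bigPar, par_F]
  have papp : ∀ L L' : List (Site (m + 1)), bigPar S (L ++ L') = bigPar S L * bigPar S L' :=
    fun L L' => by simp [bigPar]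
  by_cases hodd : Odd (m + 1)
  · have h2 : m % 2 = 0 := by grind
    have wI : wordI (opF m S) (opU m S) =
        ((sitesUU m 0 ++ sitesF m).map (opAt (m + 1) S)).prod := by
      rw [wordI, if_pos hodd, hO, opF_eq, List.map_append, List.prod_append]
    have wJ : wordJ (opE m S) (opF m S) (opU m S) =
        ((sitesE m ++ sitesUU m 1).map (opAt (m + 1) S)).prod := by
      rw [wordJ, if_pos hodd, hE, opE_eq, List.map_append, List.prod_append]
    rw [wI, wJ]
    have nI : (sitesUU m 0 ++ sitesF m).Nodup := (nodup_sitesUU 0).append nodup_sitesF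
      (disj fun s h1 h2 => by rw [mem_sitesUU' _ (by simp)] at h1; rw [mem_sitesF] at h2; omega)
    have nJ : (sitesE m ++ sitesUU m 1).Nodup := nodup_sitesE.append (nodup_sitesUU 1)
      (disj fun s h1 h2 => by rw [mem_sitesUU' _ (by simp)] at h2; rw [mem_sitesE] at h1; omega)
    have mI : ∀ s, s ∈ sitesUU m 0 ++ sitesF m ↔ s.1 % 2 = 0 := fun s => by
      rw [List.mem_append, mem_sitesUU' _ (by simp), mem_sitesF]; push_cast; omega
    have mJ : ∀ s, s ∈ sitesE m ++ sitesUU m 1 ↔ s.1 % 2 = 1 := fun s => by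
      rw [List.mem_append, mem_sitesUU' _ (by simp), mem_sitesE]; push_cast; omega
    have hκ : P.κ = quantumTwo (bigPar S (sitesE m ++ sitesUU m 1) /
        bigPar S (sitesUU m 0 ++ sitesF m)) + 2 := by
      rw [h.κ_odd hodd, papp, papp, pE, pF, hp0, hp1, show (m + 1) / 2 = m / 2 by omega,
        mul_comm ((S.a * S.b * S.c * S.d) ^ _), mul_div_mul_right_eq_div]
    constructor
    · rw [opAt_collapse (by omega) S _ _ 0 1 (by simp) nI nJ mI mJ, hκ, ← qinv, inv_div]
    · rw [opAt_collapse (by omega) S _ _ 1 0 (by simp) nJ nI mJ mI, hκ]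
  · have h2 : m % 2 = 1 := by grind
    have wI : wordI (opF m S) (opU m S) = ((sitesUU m 0).map (opAt (m + 1) S)).prod := by
      rw [wordI, if_neg hodd, hO]
    have wJ : wordJ (opE m S) (opF m S) (opU m S) =
        ((sitesE m ++ sitesUU m 1 ++ sitesF m).map (opAt (m + 1) S)).prod := by
      rw [wordJ, if_neg hodd, hE, opE_eq, opF_eq, List.map_append, List.prod_append,
        List.map_append, List.prod_append]
    rw [wI, wJ]
    have nI : (sitesUU m 0).Nodup := nodup_sitesUU 0
    have nJ : (sitesE m ++ sitesUU m 1 ++ sitesF m).Nodup :=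
      (nodup_sitesE.append (nodup_sitesUU 1)
        (disj fun s h1 h2 => by
          rw [mem_sitesUU' _ (by simp)] at h2; rw [mem_sitesE] at h1; omega)).append nodup_sitesF
        (disj fun s h1 h2 => by
          rw [List.mem_append, mem_sitesUU' _ (by simp), mem_sitesE] at h1
          rw [mem_sitesF] at h2; omega)
    have mI : ∀ s, s ∈ sitesUU m 0 ↔ s.1 % 2 = 1 := fun s => by
      rw [mem_sitesUU' _ (by simp)]; push_cast; omega
    have mJ : ∀ s, s ∈ sitesE m ++ sitesUU m 1 ++ sitesF m ↔ s.1 % 2 = 0 := fun s => by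
      rw [List.mem_append, List.mem_append, mem_sitesUU' _ (by simp), mem_sitesE, mem_sitesF]
      push_cast; omega
    have hκ : P.κ = quantumTwo (bigPar S (sitesUU m 0) /
        bigPar S (sitesE m ++ sitesUU m 1 ++ sitesF m)) + 2 := by
      rw [h.κ_even (Nat.not_odd_iff_even.1 hodd), papp, papp, pE, pF, hp0, hp1,
        show (m + 1) / 2 = m / 2 + 1 by omega]
      congr 2
      ext
      simp only [Units.val_div_eq_div_val, Units.val_mul, Units.val_pow_eq_pow_val]
      field_simp
      ring
    constructor
    · rw [opAt_collapse (by omega) S _ _ 1 0 (by simp) nI nJ mI mJ, hκ]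
    · rw [opAt_collapse (by omega) S _ _ 0 1 (by simp) nJ nI mJ mI, hκ, ← qinv, inv_div]

/-- The operators on the tensor space satisfy the defining relations of `b'_{m+1}(Π)`. -/
theorem op_satisfies (h : Compatible (m + 1) S P) :
    Satisfies P (opE m S) (opF m S) (opU m S) := by
  intro x y hxy
  cases hxy with
  | U_sq i => exact opU_sq h i
  | U_braid i j hij => exact opU_braid i j hij
  | U_comm i j hij => exact opU_comm i j hij
  | e_sq => exact opE_sq h
  | f_sq => exact opF_sq h
  | U_e_U i hi => exact opU_opE_opU h i hi
  | U_f_U i hi => exact opU_opF_opU h i hi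
  | e_U i hi => exact opE_opU i hi
  | f_U i hi => exact opF_opU i hi
  | e_f hm => exact opE_opF hm
  | I_J_I => exact (op_long h).1
  | J_I_J => exact (op_long h).2

end relations

section tensorModule

open CategoryTheory

variable {K : Type u} [Field K]

/-- The representation of `b'_n(Π)` on `V_2^{⊗ 4n}` with weights `Σ`.  For `n = 0` it is the action
of the ground field on `V_2^{⊗ 0}`. -/
noncomputable def tensorRep {S : Weights K} {P : Params K} :
    {n : ℕ} → Compatible n S P → Blob n P →ₐ[K] Module.End K (Word n →₀ K)
  | 0, _ => Blob.lift₀ P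
  | m + 1, h => Blob.lift P (opE m S) (opF m S) (opU m S) (op_satisfies h)

/-- The tensor space `V(n; Σ) = V_2^{⊗ 4n}`: the vector space with basis the words of length `4n`
in `{1, 2}`. -/
def TensorSpace {n : ℕ} {S : Weights K} {P : Params K} (_ : Compatible n S P) : Type u :=
  Word n →₀ K

variable {n : ℕ} {S : Weights K} {P : Params K}

noncomputable instance (h : Compatible n S P) : AddCommGroup (TensorSpace h) :=
  inferInstanceAs (AddCommGroup (Word n →₀ K))

noncomputable instance (h : Compatible n S P) : Module (Blob n P) (TensorSpace h) :=
  Module.compHom (Word n →₀ K) (tensorRep h).toRingHom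

/-- The number of letters `1` of a word. -/
noncomputable def ones (α : Word n) : ℕ := (Finset.univ.filter fun i => α i = 0).card

theorem ones_pair (i j : Site n) (hij : i ≠ j) (α : Word n) (h : α i ≠ α j) :
    ones (Function.update (Function.update α i 0) j 1) = ones α ∧
      ones (Function.update (Function.update α i 1) j 0) = ones α := by
  have h2 : ∀ t : Fin 2, t = 0 ∨ t = 1 := by decide
  have swap : ones (α ∘ Equiv.swap i j) = ones α := by
    unfold ones
    refine Finset.card_bij (fun s _ => Equiv.swap i j s) ?_ ?_ ?_
    · intro s hs; simpa using hs
    · intro s _ t _ hst; simpa using hst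
    · intro s hs; exact ⟨Equiv.swap i j s, by simpa using hs, by simp⟩
  have e : ∀ s t, α i = s → α j = t → Function.update (Function.update α i s) j t = α ∧
      Function.update (Function.update α i t) j s = α ∘ Equiv.swap i j := by
    rintro s t rfl rfl
    constructor
    · simp
    · funext x
      by_cases h1 : x = j
      · subst h1; simp
      · by_cases h3 : x = i
        · subst h3; simp [hij]
        · simp [h1, h3, Equiv.swap_apply_of_ne_of_ne h3 h1]
  rcases h2 (α i) with h3 | h3 <;> rcases h2 (α j) with h4 | h4
  · exact absurd (h3.trans h4.symm) h
  · obtain ⟨e1, e2⟩ := e _ _ h3 h4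
    rw [e1, e2]; exact ⟨rfl, swap⟩
  · obtain ⟨e1, e2⟩ := e _ _ h3 h4
    rw [e1, e2]; exact ⟨swap, rfl⟩
  · exact absurd (h3.trans h4.symm) h

theorem pairOp_ones (q : Kˣ) (i : Site n) (hi : i ≠ i.next) (k : ℕ) (v : Word n →₀ K)
    (hv : ∀ α, v α ≠ 0 → ones α = k) (α : Word n) (hα : pairOp q i i.next v α ≠ 0) :
    ones α = k := by
  rw [pairOp_apply hi] at hα
  have h1 : α i ≠ α i.next := by
    intro h; simp [h] at hα
  obtain ⟨h2, h3⟩ := ones_pair i i.next hi α h1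
  by_contra hne
  have e1 : v (Function.update (Function.update α i 0) i.next 1) = 0 := by
    by_contra h; exact hne (h2 ▸ hv _ h)
  have e2 : v (Function.update (Function.update α i 1) i.next 0) = 0 := by
    by_contra h; exact hne (h3 ▸ hv _ h)
  simp [e1, e2] at hα

/-- An operator that preserves the span of the words with exactly `k` letters `1`. -/
def Keeps (k : ℕ) (T : Module.End K (Word n →₀ K)) : Prop :=
  ∀ v : Word n →₀ K, (∀ α, v α ≠ 0 → ones α = k) → ∀ α, T v α ≠ 0 → ones α = k

theorem Keeps.mul {k : ℕ} {T T' : Module.End K (Word n →₀ K)} (h : Keeps k T) (h' : Keeps k T') :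
    Keeps k (T * T') := fun v hv => h _ (h' v hv)

theorem Keeps.add {k : ℕ} {T T' : Module.End K (Word n →₀ K)} (h : Keeps k T) (h' : Keeps k T') :
    Keeps k (T + T') := fun v hv α hα => by
  by_cases h1 : T v α = 0
  · refine h' v hv α fun h2 => hα ?_
    simp [h1, h2]
  · exact h v hv α h1

theorem Keeps.R {k : ℕ} {m : ℕ} (q : Kˣ) {s : ℤ} (hs) : Keeps k (R (m + 1) q s hs) :=
  pairOp_ones q _ (Site.ne_next (Nat.succ_pos m) _) k

theorem tensorRep_gen (h : Compatible n S P) (k : ℕ) (g : Gen n) :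
    Keeps k (tensorRep h (Blob.gen P g)) := by
  cases g with
  | e =>
    simp only [tensorRep, Blob.lift_gen, genVal, opE]
    exact (Keeps.R _ _).mul (Keeps.R _ _)
  | f =>
    simp only [tensorRep, Blob.lift_gen, genVal, opF]
    exact (Keeps.R _ _).mul (Keeps.R _ _)
  | U i =>
    simp only [tensorRep, Blob.lift_gen, genVal, opU]
    exact (((Keeps.R _ _).mul (Keeps.R _ _)).mul (Keeps.R _ _)).mul (Keeps.R _ _)

theorem tensorRep_ones (h : Compatible n S P) (x : Blob n P) (k : ℕ) :
    Keeps k (tensorRep h x) := by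
  obtain ⟨y, rfl⟩ := RingQuot.mkAlgHom_surjective K (Rel P n) x
  induction y using FreeAlgebra.induction with
  | grade0 r =>
    intro v hv α hα
    simp only [AlgHom.commutes, Module.algebraMap_end_apply, Finsupp.smul_apply] at hα
    exact hv α fun h => hα (by simp [h])
  | grade1 g => exact tensorRep_gen h k g
  | mul a b ha hb => simpa only [map_mul] using ha.mul hb
  | add a b ha hb => simpa only [map_add] using ha.add hb

/-- The permutation module `M_n(r) ⊆ V(n; Σ)`: the span of the words with `2n + r` letters `1`
(hence `2n - r` letters `2`). -/
noncomputable def permModule (h : Compatible n S P) (r : ℤ) :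
    Submodule (Blob n P) (TensorSpace h) where
  carrier := {v : Word n →₀ K | ∀ α, v α ≠ 0 → (ones α : ℤ) = 2 * n + r}
  zero_mem' α hα := absurd rfl hα
  add_mem' {v w} hv hw α hα := by
    by_cases h1 : (show Word n →₀ K from v) α = 0
    · refine hw α fun h2 => hα ?_
      exact (congrArg₂ (· + ·) h1 h2).trans (add_zero 0)
    · exact hv α h1
  smul_mem' x v hv α hα := by
    by_cases hk : 0 ≤ 2 * (n : ℤ) + r
    · have := tensorRep_ones h x (2 * (n : ℤ) + r).toNat v
        (fun α h => by have := hv α h; omega) α hα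
      omega
    · have hv0 : v = 0 := Finsupp.ext fun α => by
        by_contra h; have := hv α h; omega
      subst hv0
      exact absurd (congrFun (congrArg DFunLike.coe (map_zero (tensorRep h x))) α) hα

end tensorModule

end SympBlob

open CategoryTheory

/-! On two tensor factors `R^q` has rank one: with v_q = q·12 + 21 it equals q⁻¹ v_q v_qᵀ, and v_qᵀ
v_q = q² + 1 gives R^q v_q = [2]_q v_q. In `b'_{n+1}` the generator e acts by two such operators, on
the pairs of positions (-(n+1), -n) and (n+1, n+2). When δ_L ≠ 0 its image therefore consists of the
vectors carrying v_x and v_y at these pairs and an arbitrary vector at the other 4n positions.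
Relabelling those positions in order gives an injection θ = `insertE` of V(n; Σ_L) into V(n+1; Σ)
whose image is ē V(n+1; Σ) (`pairOp_mem_range_insertPairs`, `eBar_insertE`). For f the pairs are (0,
1) and (2(n+1), -2n-1), the second one going round the cycle.

The point is that θ commutes with `b'_n`, which is checked on generators. Relabelling preserves
cyclic adjacency except across the two removed pairs, so every generator of the smaller algebra
except e becomes a generator of the larger one: f stays f, and U_i becomes U_{i+1}. The generator e
acts precisely across the removed pairs. Contracting v_p with the inner legs of v_a and v_b gives
p·v_{ab/p}, whence R^p_{jk} R^a_{ij} R^b_{kl} sends v_p ⊗ ψ to v_p ⊗ R^{ab/p}_{il} ψ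
(`pairOp_contract`). In e U_1 this occurs once with (x; a, b) and once with (y; c, d), which is
where the entries ab/x and cd/y of Σ_L come from. The factor δ_L in the image of e cancels the
denominator of ē, so no scalar is left over. For f the triples are (z; b, c) and (w; d, a).

Each inserted vector involves only words with one letter 1 and one letter 2. Hence θ raises the
number of letters 1 by 2, from 2n + r to 2(n+1) + r, and r does not change (`ones_insertPairs`).
`truncation_permModule_iso` turns this into an isomorphism valid for every r. If |r| > 2n, no word
of length 4n has 2n + r letters 1, so the localised module is isomorphic to zero. -/

namespace SympBlob

/-! ### Inserting the eigenvectors of two pair operators into words. -/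

section insertion

set_option linter.unusedSectionVars false

variable {K : Type*} [Field K] {X Y : Type*} [DecidableEq X] [DecidableEq Y] [Finite X]

/-- The positions `j, k, j', k'` are distinct and complementary to the range of the injection `σ`. -/
structure Slots (σ : Y → X) (j k j' k' : X) : Prop where
  inj : Function.Injective σ
  jk : j ≠ k
  jj' : j ≠ j'
  jk' : j ≠ k'
  kj' : k ≠ j'
  kk' : k ≠ k'
  j'k' : j' ≠ k'
  ne_j : ∀ s, σ s ≠ j
  ne_k : ∀ s, σ s ≠ k
  ne_j' : ∀ s, σ s ≠ j'
  ne_k' : ∀ s, σ s ≠ k'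
  cover : ∀ i, i = j ∨ i = k ∨ i = j' ∨ i = k' ∨ ∃ s, σ s = i

variable {σ : Y → X} {j k j' k' : X} {p q : Kˣ}

/-- The two inserted pairs play equal roles. With `insertPairs_symm`, every statement about the
first pair applies to the second. -/
theorem Slots.symm (h : Slots σ j k j' k') : Slots σ j' k' j k where
  inj := h.inj
  jk := h.j'k'
  jj' := h.jj'.symm
  jk' := h.kj'.symm
  kj' := h.jk'.symm
  kk' := h.kk'.symm
  j'k' := h.jk
  ne_j := h.ne_j'
  ne_k := h.ne_k'
  ne_j' := h.ne_j
  ne_k' := h.ne_k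
  cover i := by have := h.cover i; tauto

/-- Insertion of the vectors `p ⬝ 12 + 21` at the positions `j, k` and `q ⬝ 12 + 21` at `j', k'`. -/
noncomputable def insertPairs (σ : Y → X) (p : Kˣ) (j k : X) (q : Kˣ) (j' k' : X) :
     ((Y → Fin 2) →₀ K) →ₗ[K] ((X → Fin 2) →₀ K) where
  toFun ψ := Finsupp.equivFunOnFinite.symm fun β =>
    wt p (β j) (β k) * wt q (β j') (β k') * ψ (β ∘ σ)
  map_add' ψ φ := by ext β; simp [mul_add]
  map_smul' c ψ := by ext β; simp; ring

theorem insertPairs_apply (ψ : (Y → Fin 2) →₀ K) (β : X → Fin 2) :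
    insertPairs σ p j k q j' k' ψ β = wt p (β j) (β k) * wt q (β j') (β k') * ψ (β ∘ σ) := rfl

theorem insertPairs_symm :
    insertPairs σ p j k q j' k' = insertPairs σ q j' k' p j k := by
  ext1 α; ext β
  simp only [LinearMap.comp_apply, insertPairs_apply, mul_comm (wt p _ _)]

theorem update_comp_of_ne {i : X} (hi : ∀ s, σ s ≠ i) (β : X → Fin 2) (u : Fin 2) :
    Function.update β i u ∘ σ = β ∘ σ := by
  funext s; simp [hi s]

theorem update_comp_apply (hσ : Function.Injective σ) (s : Y) (β : X → Fin 2) (u : Fin 2) :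
    Function.update β (σ s) u ∘ σ = Function.update (β ∘ σ) s u :=
  Function.update_comp_eq_of_injective β hσ s u

/-- An operator away from the inserted pairs. -/
theorem pairOp_insertPairs (h : Slots σ j k j' k') {s t : Y} (hst : s ≠ t) (a : Kˣ)
    (ψ : (Y → Fin 2) →₀ K) :
    pairOp a (σ s) (σ t) (insertPairs σ p j k q j' k' ψ) =
      insertPairs σ p j k q j' k' (pairOp a s t ψ) := by
  ext β
  simp only [pairOp_apply (h.inj.ne hst), insertPairs_apply, pairOp_apply hst,
    update_comp_apply h.inj, Function.update_of_ne (h.ne_j _).symm,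
    Function.update_of_ne (h.ne_k _).symm, Function.update_of_ne (h.ne_j' _).symm,
    Function.update_of_ne (h.ne_k' _).symm, Function.comp_apply]
  ring

/-- The operator at an inserted pair. -/
theorem pairOp_insertPairs_self (h : Slots σ j k j' k') (ψ : (Y → Fin 2) →₀ K) :
    pairOp p j k (insertPairs σ p j k q j' k' ψ) =
      quantumTwo p • insertPairs σ p j k q j' k' ψ := by
  ext β
  -- Evaluated on the inserted vector, the operator produces the scalar p⁻¹ (p·p + 1) = p + p⁻¹.
  simp only [pairOp_apply h.jk, insertPairs_apply, update_comp_of_ne h.ne_j,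
    update_comp_of_ne h.ne_k, Function.update_self, Function.update_of_ne h.jk,
    Function.update_of_ne h.jj'.symm, Function.update_of_ne h.kj'.symm,
    Function.update_of_ne h.jk'.symm, Function.update_of_ne h.kk'.symm,
    Finsupp.smul_apply, smul_eq_mul, wt_01, wt_10, quantumTwo, Units.val_inv_eq_inv_val]
  field_simp

/-- Contraction of two operators adjacent to an inserted pair. -/
theorem pairOp_contract (h : Slots σ j k j' k') {s t : Y} (hst : s ≠ t) (a b : Kˣ)
    (ψ : (Y → Fin 2) →₀ K) :
    pairOp p j k (pairOp a (σ s) j (pairOp b k (σ t) (insertPairs σ p j k q j' k' ψ))) =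
      insertPairs σ p j k q j' k' (pairOp (a * b / p) s t ψ) := by
  ext β
  have hst' := h.inj.ne hst
  have h2 : ∀ t : Fin 2, t = 0 ∨ t = 1 := by decide
  -- Everything is expanded into coefficients. Summing over the letters at `j, k`, the choice 12
  -- survives only for outer letters 21, with weight p, and the choice 21 only for outer letters 12,
  -- with weight ab. This is p times the vector of parameter ab/p. It occurs once on the input side
  -- and once on the output side, and p² · (pab)⁻¹ = (ab/p)⁻¹ is the normalisation of the new
  -- operator.
  simp only [pairOp_apply h.jk, pairOp_apply (h.ne_j s), pairOp_apply (h.ne_k t).symm,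
    insertPairs_apply, update_comp_of_ne h.ne_j, pairOp_apply hst,
    update_comp_of_ne h.ne_k, update_comp_apply h.inj, Function.update_self,
    Function.update_of_ne h.jk, Function.update_of_ne h.jk.symm,
    Function.update_of_ne h.jj'.symm, Function.update_of_ne h.kj'.symm,
    Function.update_of_ne h.jk'.symm, Function.update_of_ne h.kk'.symm,
    Function.update_of_ne (h.ne_j _), Function.update_of_ne (h.ne_k _),
    Function.update_of_ne (h.ne_j _).symm, Function.update_of_ne (h.ne_k _).symm,
    Function.update_of_ne (h.ne_j' _).symm, Function.update_of_ne (h.ne_k' _).symm,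
    Function.update_of_ne hst'.symm, Function.comp_apply]
  -- Both sides vanish when the outer letters agree; the two other cases are the weights 12 and 21.
  rcases h2 (β (σ s)) with h3 | h3 <;> rcases h2 (β (σ t)) with h4 | h4 <;>
    simp [h3, h4] <;> field_simp

/-- The extension of a word by the letters `21` at both inserted pairs. -/
noncomputable def liftWord (σ : Y → X) (j k j' k' : X) (α : Y → Fin 2) : X → Fin 2 :=
  Function.update (Function.update (Function.update (Function.update
    (Function.extend σ α 0) j 1) k 0) j' 1) k' 0

theorem liftWord_comp (h : Slots σ j k j' k') (α : Y → Fin 2) :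
    liftWord σ j k j' k' α ∘ σ = α := by
  funext s
  simp [liftWord, h.ne_j, h.ne_k, h.ne_j', h.ne_k', h.inj.extend_apply]

/-- The letters 21 are chosen in `liftWord` because their weight is 1 for every parameter, so a
coefficient of `ψ` is read off without division. -/
theorem insertPairs_liftWord (h : Slots σ j k j' k') (ψ : (Y → Fin 2) →₀ K) (α : Y → Fin 2) :
    insertPairs σ p j k q j' k' ψ (liftWord σ j k j' k' α) = ψ α := by
  rw [insertPairs_apply, liftWord_comp h]
  simp [liftWord, h.jk, h.jj', h.jk', h.kj', h.kk', h.j'k']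

theorem insertPairs_injective (h : Slots σ j k j' k') :
    Function.Injective (insertPairs σ p j k q j' k') := by
  intro ψ φ e
  ext α
  rw [← insertPairs_liftWord (p := p) (q := q) h ψ, e, insertPairs_liftWord h]

/-- A value of the rank-one operator depends on the letters at its own pair only through the factor
`wt`. After both operators have acted, the coefficient at `β` is the product of the two weights and
a function of the letters outside the slots. -/
theorem pairOp_mem_range_insertPairs [Finite Y] (h : Slots σ j k j' k') (φ : (X → Fin 2) →₀ K) :
    pairOp p j k (pairOp q j' k' φ) ∈ LinearMap.range (insertPairs σ p j k q j' k') := by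
  -- The preimage is sampled at the words with 21 in both pairs, where both weights are 1.
  refine ⟨Finsupp.equivFunOnFinite.symm fun α =>
    pairOp p j k (pairOp q j' k' φ) (liftWord σ j k j' k' α), ?_⟩
  ext β
  -- By `cover`, a position outside the slots lies in the range of `σ`, so the default letter of
  -- `Function.extend` never survives.
  have e : ∀ i, i ≠ j → i ≠ k → i ≠ j' → i ≠ k' → liftWord σ j k j' k' (β ∘ σ) i = β i := by
    intro i h1 h2 h3 h4
    rcases h.cover i with h5 | h5 | h5 | h5 | ⟨s, rfl⟩
    · exact absurd h5 h1
    · exact absurd h5 h2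
    · exact absurd h5 h3
    · exact absurd h5 h4
    · simp [liftWord, h1, h2, h3, h4, h.inj.extend_apply]
  -- Once all four slots are overwritten, `β` and the lifted word can no longer be told apart.
  have e' : ∀ u v u' v', Function.update (Function.update (Function.update (Function.update
      (liftWord σ j k j' k' (β ∘ σ)) j u) k v) j' u') k' v' =
      Function.update (Function.update (Function.update (Function.update β j u) k v) j' u') k' v' := by
    intro u v u' v'
    funext i
    simp only [Function.update_apply]
    split_ifs with h1 h2 h3 h4
    · rfl
    · rfl
    · rfl
    · rfl
    · exact e i h4 h3 h2 h1
  simp only [insertPairs_apply, pairOp_apply h.jk, pairOp_apply h.j'k',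
    Finsupp.equivFunOnFinite_symm_apply_apply, e',
    Function.update_of_ne h.jj'.symm, Function.update_of_ne h.kj'.symm,
    Function.update_of_ne h.jk'.symm, Function.update_of_ne h.kk'.symm]
  have l1 : wt p (liftWord σ j k j' k' (β ∘ σ) j) (liftWord σ j k j' k' (β ∘ σ) k) = (1 : K) := by
    simp [liftWord, h.jk, h.jj', h.jk', h.kj', h.kk']
  have l2 : wt q (liftWord σ j k j' k' (β ∘ σ) j') (liftWord σ j k j' k' (β ∘ σ) k') = (1 : K) := by
    simp [liftWord, h.j'k']
  rw [l1, l2]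
  ring

/-- The positions are the range of `σ` together with the four slots, and a pair of unequal letters
contains exactly one letter 1, encoded as `0`. Two pairs contribute 2. -/
theorem card_zeros [Fintype X] [Fintype Y] (h : Slots σ j k j' k') (β : X → Fin 2)
    (h1 : β j ≠ β k) (h2 : β j' ≠ β k') :
    (Finset.univ.filter fun i => β i = 0).card =
      (Finset.univ.filter fun s => (β ∘ σ) s = 0).card + 2 := by
  classical
  have e : (Finset.univ : Finset X) = Finset.univ.map ⟨σ, h.inj⟩ ∪ {j, k, j', k'} := by
    ext i
    have := h.cover i
    simp only [Finset.mem_univ, Finset.mem_union, Finset.mem_map, Function.Embedding.coeFn_mk,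
      true_and, Finset.mem_insert, Finset.mem_singleton, true_iff]
    tauto
  have hd : Disjoint (Finset.univ.map ⟨σ, h.inj⟩) ({j, k, j', k'} : Finset X) := by
    rw [Finset.disjoint_left]
    intro i hi
    obtain ⟨s, _, rfl⟩ := Finset.mem_map.1 hi
    simp [h.ne_j, h.ne_k, h.ne_j', h.ne_k']
  have h3 : ∀ u v : Fin 2, u ≠ v → (if u = 0 then 1 else 0) + (if v = 0 then 1 else 0) = 1 := by
    decide
  simp only [Finset.card_filter]
  rw [e, Finset.sum_union hd, Finset.sum_map]
  simp only [Function.Embedding.coeFn_mk, Function.comp_apply]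
  congr 1
  rw [Finset.sum_insert (by simp [h.jk, h.jj', h.jk']), Finset.sum_insert (by simp [h.kj', h.kk']),
    Finset.sum_pair h.j'k', ← add_assoc, h3 _ _ h1, h3 _ _ h2]

end insertion

end SympBlob

namespace SympBlob

/-! ### From an intertwining injection to an isomorphism of truncated permutation modules. -/

section transfer

open CategoryTheory

universe u

variable {K : Type u} [Field K] {n : ℕ} {S S' : Weights K} {P Q : Params K}

theorem tensorRep_toCorner (h : Compatible n S P) {p : Blob n P} (hp : IsIdempotentElem p)
    (a : Blob n P) (v : Word n →₀ K) :
    tensorRep h (toCorner hp a).1 v = tensorRep h p (tensorRep h a (tensorRep h p v)) := by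
  simp [toCorner_val, mul_assoc]

/-- A map that intertwines the generators intertwines the action of `b'_n`. -/
theorem tensorRep_intertwine (h : Compatible (n + 1) S P) (h' : Compatible n S' Q)
    {p : Blob (n + 1) P} (hp : IsIdempotentElem p) (χ : Blob n Q →ₐ[K] hp.Corner)
    (θ : (Word n →₀ K) →ₗ[K] (Word (n + 1) →₀ K)) (hfix : ∀ ψ, tensorRep h p (θ ψ) = θ ψ)
    (hgen : ∀ (g : Gen n) ψ,
      tensorRep h (χ (Blob.gen Q g)).1 (θ ψ) = θ (tensorRep h' (Blob.gen Q g) ψ))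
    (b : Blob n Q) (ψ : Word n →₀ K) :
    tensorRep h (χ b).1 (θ ψ) = θ (tensorRep h' b ψ) := by
  obtain ⟨y, rfl⟩ := RingQuot.mkAlgHom_surjective K (Rel Q n) b
  induction y using FreeAlgebra.induction generalizing ψ with
  | grade0 r =>
    -- The unit of the corner is `p`, so a scalar `r` acts as `r • p`; `hfix` makes this `r` on the
    -- image of `θ`. For `n = 0`, where there are no generators, only scalars, sums and products
    -- remain.
    rw [AlgHom.commutes, AlgHom.commutes, AlgHom.commutes, Algebra.algebraMap_eq_smul_one,
      corner_val_smul, corner_val_one, map_smul, LinearMap.smul_apply, hfix]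
    simp
  | grade1 g => exact hgen g ψ
  | mul a b ha hb =>
    simp only [map_mul, corner_val_mul, Module.End.mul_apply, hb, ha]
  | add a b ha hb =>
    have e : ∀ x y : hp.Corner, (x + y).1 = x.1 + y.1 := fun _ _ => rfl
    simp only [map_add, e, LinearMap.add_apply, hb, ha]

/-- The hypotheses identify `θ` as an equivariant bijection from the smaller tensor space onto the
`p`-truncation of the larger one. Since `hones` is an equivalence, `θ` matches the permutation
submodules in both directions, and it is this restriction that gives the isomorphism. -/
theorem truncation_permModule_iso (h : Compatible (n + 1) S P) (h' : Compatible n S' Q)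
    {p : Blob (n + 1) P} (hp : IsIdempotentElem p) (χ : Blob n Q →ₐ[K] hp.Corner)
    (θ : (Word n →₀ K) →ₗ[K] (Word (n + 1) →₀ K)) (hfix : ∀ ψ, tensorRep h p (θ ψ) = θ ψ)
    (hinj : Function.Injective θ) (hrange : ∀ φ, tensorRep h p φ ∈ LinearMap.range θ)
    (hgen : ∀ (g : Gen n) ψ,
      tensorRep h (χ (Blob.gen Q g)).1 (θ ψ) = θ (tensorRep h' (Blob.gen Q g) ψ))
    (r : ℤ) (hones : ∀ ψ : Word n →₀ K,
      (∀ β, θ ψ β ≠ 0 → (ones β : ℤ) = 2 * (n + 1 : ℕ) + r) ↔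
        ∀ α, ψ α ≠ 0 → (ones α : ℤ) = 2 * n + r) :
    Nonempty ((truncFunctor hp ⋙ ModuleCat.restrictScalars χ.toRingHom).obj
        (ModuleCat.of _ (permModule h r)) ≅ ModuleCat.of (Blob n Q) (permModule h' r)) := by
  -- Membership in the truncation is witnessed by `θ ψ` itself, because `p` fixes it.
  let Φ : permModule h' r →ₗ[Blob n Q]
      (truncFunctor hp ⋙ ModuleCat.restrictScalars χ.toRingHom).obj
        (ModuleCat.of _ (permModule h r)) :=
    { toFun := fun ψ => (⟨⟨θ ψ.1, (hones ψ.1).2 ψ.2⟩,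
        ⟨⟨θ ψ.1, (hones ψ.1).2 ψ.2⟩, Subtype.ext (hfix ψ.1)⟩⟩ : Trunc hp (permModule h r))
      map_add' := fun ψ φ => Subtype.ext (Subtype.ext (map_add θ ψ.1 φ.1))
      map_smul' := fun b ψ => Subtype.ext (Subtype.ext
        (tensorRep_intertwine h h' hp χ θ hfix hgen b ψ.1).symm) }
  have hΦ : Function.Bijective Φ := by
    constructor
    · intro ψ φ e
      exact Subtype.ext (hinj (congrArg (fun x : Trunc hp (permModule h r) => x.1.1) e))
    · rintro ⟨⟨v, hv⟩, ⟨w, hw⟩⟩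
      -- An element of the truncation is `p` applied to some `w`, so it comes from some `ψ` in the
      -- whole tensor space; the converse half of `hones` then puts `ψ` into the permutation module.
      obtain ⟨ψ, hψ⟩ := hrange w.1
      have e : θ ψ = v := hψ.trans (congrArg Subtype.val hw)
      subst e
      exact ⟨⟨ψ, (hones ψ).1 hv⟩, rfl⟩
  exact ⟨(LinearEquiv.ofBijective Φ hΦ).toModuleIso.symm⟩

/-- There are no words with more than `4n` or less than `0` letters `1`. -/
theorem permModule_isZero (h : Compatible n S P) {r : ℤ} (hr : 2 * (n : ℤ) < |r|) :
    Limits.IsZero (ModuleCat.of (Blob n P) (permModule h r)) := by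
  have : Subsingleton (permModule h r) := by
    refine ⟨fun v w => ?_⟩
    have key : ∀ v : permModule h r, v = 0 := by
      rintro ⟨v, hv⟩
      refine Subtype.ext (Finsupp.ext fun α => ?_)
      by_contra h0
      have h1 := hv α h0
      -- A word has 4n positions, while 2n + r exceeds 4n or is negative.
      have h2 : ones α ≤ 4 * n := by
        refine (Finset.card_le_univ _).trans ?_
        rw [Fintype.card_coe, Int.card_Icc]
        omega
      rcases lt_abs.1 hr with h3 | h3 <;> omega
    rw [key v, key w]
  exact ModuleCat.isZero_of_subsingleton _

end transfer

/-! ### Letter counts and intertwining for cyclic words. -/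

section operators

universe u

variable {K : Type u} [Field K] {n : ℕ} {S : Weights K} {P : Params K}

/-- Words occurring in an inserted vector have unequal letters in each pair, hence two more letters
1 than their restriction along `σ`. The shift from 2n to 2(n+1) absorbs these two, which is why `r`
is preserved. -/
theorem ones_insertPairs {σ : Site n → Site (n + 1)} {j k j' k' : Site (n + 1)}
    (h : Slots σ j k j' k') (p q : Kˣ) (r : ℤ) (ψ : Word n →₀ K) :
    (∀ β, insertPairs σ p j k q j' k' ψ β ≠ 0 → (ones β : ℤ) = 2 * (n + 1 : ℕ) + r) ↔
      ∀ α, ψ α ≠ 0 → (ones α : ℤ) = 2 * n + r := by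
  constructor
  · intro H α hα
    -- A word in the support of `ψ` lifts to a word in the support of the inserted vector, with the
    -- same coefficient.
    have h1 := H (liftWord σ j k j' k' α) (by rwa [insertPairs_liftWord h])
    have h2 := card_zeros h (liftWord σ j k j' k' α)
      (by simp [liftWord, h.jk, h.jj', h.jk', h.kj', h.kk'])
      (by simp [liftWord, h.j'k'])
    rw [liftWord_comp h] at h2
    unfold ones at *
    push_cast at *
    omega
  · intro H β hβ
    rw [insertPairs_apply] at hβ
    have h1 := H _ (right_ne_zero_of_mul hβ)
    -- A non-zero coefficient forces both weights to be non-zero, so the letters within each pair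
    -- differ.
    have h2 := card_zeros h β
      (fun e => left_ne_zero_of_mul (left_ne_zero_of_mul hβ) (by rw [e, wt_self]))
      (fun e => right_ne_zero_of_mul (left_ne_zero_of_mul hβ) (by rw [e, wt_self]))
    unfold ones at *
    push_cast at *
    omega

/-- `θ` intertwines the operators `T` and `T'`. -/
def Intertwines (θ : (Word n →₀ K) →ₗ[K] (Word (n + 1) →₀ K))
    (T : Module.End K (Word n →₀ K)) (T' : Module.End K (Word (n + 1) →₀ K)) : Prop :=
  ∀ ψ, T' (θ ψ) = θ (T ψ)

theorem Intertwines.mul {θ : (Word n →₀ K) →ₗ[K] (Word (n + 1) →₀ K)}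
    {T₁ T₂ : Module.End K (Word n →₀ K)} {T₁' T₂' : Module.End K (Word (n + 1) →₀ K)}
    (h₁ : Intertwines θ T₁ T₁') (h₂ : Intertwines θ T₂ T₂') :
    Intertwines θ (T₁ * T₂) (T₁' * T₂') := fun ψ => by
  simp only [Module.End.mul_apply, h₂ ψ, h₁ (T₂ ψ)]

/-- Transport of an operator whose two positions stay neighbours: `e₂` says that nothing has been
inserted between `s` and its successor. -/
theorem intertwines_R (hn : 0 < n) {σ : Site n → Site (n + 1)} {j k j' k' : Site (n + 1)}
    (h : Slots σ j k j' k') (p q a : Kˣ) {s s' : ℤ} (hs) (hs')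
    (e₁ : σ ⟨s, hs⟩ = ⟨s', hs'⟩) (e₂ : σ (Site.next ⟨s, hs⟩) = Site.next (σ ⟨s, hs⟩)) :
    Intertwines (insertPairs σ p j k q j' k') (R n a s hs) (R (n + 1) a s' hs') := fun ψ => by
  unfold R
  rw [← e₁, ← e₂, pairOp_insertPairs h (Site.ne_next hn _)]

/-- The complementary case, in which the pair `t, l` has been inserted between `s` and its
successor. The hypotheses describe the chain i → t → l → σ(next s) on the larger cycle with i =
σ(s), and `pairOp_contract` applies to it. -/
theorem intertwines_contract (hn : 0 < n) {σ : Site n → Site (n + 1)} {j' k' : Site (n + 1)}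
    {s i t l : ℤ} {ht : t ∈ _} {hl : l ∈ _} (h : Slots σ ⟨t, ht⟩ ⟨l, hl⟩ j' k') (p q a b : Kˣ)
    (hs) (hi) (e₁ : σ ⟨s, hs⟩ = ⟨i, hi⟩) (e₂ : Site.next ⟨i, hi⟩ = ⟨t, ht⟩)
    (e₃ : Site.next ⟨t, ht⟩ = ⟨l, hl⟩) (e₄ : σ (Site.next ⟨s, hs⟩) = Site.next ⟨l, hl⟩) :
    Intertwines (insertPairs σ p ⟨t, ht⟩ ⟨l, hl⟩ q j' k') (R n (a * b / p) s hs)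
      (R (n + 1) p t ht * (R (n + 1) a i hi * R (n + 1) b l hl)) := fun ψ => by
  unfold R
  rw [Module.End.mul_apply, Module.End.mul_apply, e₂, e₃, ← e₁, ← e₄,
    pairOp_contract h (Site.ne_next hn _)]

end operators

end SympBlob

namespace SympBlob

/-! ### The positions removed by e and by f, and the images of the generators. -/

section sites

universe u

variable {K : Type u} [Field K] {n m : ℕ} {S : Weights K} {P : Params K}

/-- The inclusion of positions that skips the four positions of `e`. -/
def skipE (n : ℕ) (s : Site n) : Site (n + 1) :=
  ⟨if s.1 ≤ -n then s.1 - 2 else if s.1 ≤ n then s.1 else s.1 + 2, by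
    have := Finset.mem_Icc.1 s.2
    rw [Finset.mem_Icc]
    split_ifs <;> omega⟩

/-- The inclusion of positions that skips the four positions of `f`. -/
def skipF (n : ℕ) (s : Site n) : Site (n + 1) :=
  ⟨if s.1 ≤ 0 then s.1 - 1 else s.1 + 1, by
    have := Finset.mem_Icc.1 s.2
    rw [Finset.mem_Icc]
    split_ifs <;> omega⟩

theorem skipE_val (s : Site n) :
    (skipE n s).1 = if s.1 ≤ -n then s.1 - 2 else if s.1 ≤ n then s.1 else s.1 + 2 := rfl

theorem skipF_val (s : Site n) : (skipF n s).1 = if s.1 ≤ 0 then s.1 - 1 else s.1 + 1 := rfl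

/-- The removed pairs lie just after the images of -n and n. These are exactly the positions of e on
the smaller cycle, so all other generators avoid them. -/
theorem skipE_next (s : Site n) (h₁ : s.1 ≠ -n) (h₂ : s.1 ≠ n) :
    skipE n s.next = (skipE n s).next := by
  have := Finset.mem_Icc.1 s.2
  apply Subtype.ext
  simp only [skipE_val, Site.next_val]
  split_ifs <;> omega

/-- The pair (0, 1) is removed just after the image of 0, and the pair closing the cycle just after
the image of 2n. These are the positions of f on the smaller cycle. -/
theorem skipF_next (s : Site n) (h₁ : s.1 ≠ 0) (h₂ : s.1 ≠ 2 * n) :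
    skipF n s.next = (skipF n s).next := by
  have := Finset.mem_Icc.1 s.2
  apply Subtype.ext
  simp only [skipF_val, Site.next_val]
  split_ifs <;> omega

theorem slots_skipE (n : ℕ) : Slots (skipE n)
    ⟨-(n + 1), by rw [Finset.mem_Icc]; omega⟩ ⟨-n, by rw [Finset.mem_Icc]; omega⟩
    ⟨n + 1, by rw [Finset.mem_Icc]; omega⟩ ⟨n + 2, by rw [Finset.mem_Icc]; omega⟩ where
  inj s t h := by
    replace h := congrArg Subtype.val h
    simp only [skipE_val] at h
    apply Subtype.ext
    split_ifs at h <;> omega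
  jk h := by replace h := congrArg Subtype.val h; simp only at h; omega
  jj' h := by replace h := congrArg Subtype.val h; simp only at h; omega
  jk' h := by replace h := congrArg Subtype.val h; simp only at h; omega
  kj' h := by replace h := congrArg Subtype.val h; simp only at h; omega
  kk' h := by replace h := congrArg Subtype.val h; simp only at h; omega
  j'k' h := by replace h := congrArg Subtype.val h; simp only at h; omega
  ne_j s h := by
    replace h := congrArg Subtype.val h; simp only [skipE_val] at h; split_ifs at h <;> omega
  ne_k s h := by
    replace h := congrArg Subtype.val h; simp only [skipE_val] at h; split_ifs at h <;> omega
  ne_j' s h := by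
    replace h := congrArg Subtype.val h; simp only [skipE_val] at h; split_ifs at h <;> omega
  ne_k' s h := by
    replace h := congrArg Subtype.val h; simp only [skipE_val] at h; split_ifs at h <;> omega
  cover i := by
    have hi := Finset.mem_Icc.1 i.2
    simp only [Subtype.ext_iff]
    by_contra! hc
    obtain ⟨h1, h2, h3, h4, h5⟩ := hc
    -- This inverts `skipE` off the slots: the outer arcs move back by two and the middle one stays.
    refine h5 ⟨if i.1 < -(n + 1) then i.1 + 2 else if i.1 ≤ n then i.1 else i.1 - 2, ?_⟩ ?_
    · rw [Finset.mem_Icc]; split_ifs <;> omega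
    · simp only [skipE_val]; split_ifs <;> omega

/-- The last slot -2n-1 is the first position of the larger cycle, hence the successor of the final
position 2(n+1). -/
theorem slots_skipF (n : ℕ) : Slots (skipF n)
    ⟨0, by rw [Finset.mem_Icc]; omega⟩ ⟨1, by rw [Finset.mem_Icc]; omega⟩
    ⟨2 * (n + 1), by rw [Finset.mem_Icc]; omega⟩
    ⟨-2 * n - 1, by rw [Finset.mem_Icc]; omega⟩ where
  inj s t h := by
    replace h := congrArg Subtype.val h
    simp only [skipF_val] at h
    apply Subtype.ext
    split_ifs at h <;> omega
  jk h := by replace h := congrArg Subtype.val h; simp only at h; omega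
  jj' h := by replace h := congrArg Subtype.val h; simp only at h; omega
  jk' h := by replace h := congrArg Subtype.val h; simp only at h; omega
  kj' h := by replace h := congrArg Subtype.val h; simp only at h; omega
  kk' h := by replace h := congrArg Subtype.val h; simp only at h; omega
  j'k' h := by replace h := congrArg Subtype.val h; simp only at h; omega
  ne_j s h := by
    replace h := congrArg Subtype.val h; simp only [skipF_val] at h; split_ifs at h <;> omega
  ne_k s h := by
    replace h := congrArg Subtype.val h; simp only [skipF_val] at h; split_ifs at h <;> omega
  ne_j' s h := by
    have := Finset.mem_Icc.1 s.2
    replace h := congrArg Subtype.val h; simp only [skipF_val] at h; split_ifs at h <;> omega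
  ne_k' s h := by
    have := Finset.mem_Icc.1 s.2
    replace h := congrArg Subtype.val h; simp only [skipF_val] at h; split_ifs at h <;> omega
  cover i := by
    have hi := Finset.mem_Icc.1 i.2
    simp only [Subtype.ext_iff]
    by_contra! hc
    obtain ⟨h1, h2, h3, h4, h5⟩ := hc
    -- This inverts `skipF` off the slots; each half moves back by one towards the middle.
    refine h5 ⟨if i.1 < 0 then i.1 + 1 else i.1 - 1, ?_⟩ ?_
    · rw [Finset.mem_Icc]; split_ifs <;> omega
    · simp only [skipF_val]; split_ifs <;> omega

/-- Insertion of the image of `e` into words. -/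
noncomputable def insertE (n : ℕ) (S : Weights K) : (Word n →₀ K) →ₗ[K] (Word (n + 1) →₀ K) :=
  insertPairs (skipE n) S.x ⟨-(n + 1), by rw [Finset.mem_Icc]; omega⟩
    ⟨-n, by rw [Finset.mem_Icc]; omega⟩ S.y ⟨n + 1, by rw [Finset.mem_Icc]; omega⟩
    ⟨n + 2, by rw [Finset.mem_Icc]; omega⟩

/-- Insertion of the image of `f` into words. -/
noncomputable def insertF (n : ℕ) (S : Weights K) : (Word n →₀ K) →ₗ[K] (Word (n + 1) →₀ K) :=
  insertPairs (skipF n) S.z ⟨0, by rw [Finset.mem_Icc]; omega⟩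
    ⟨1, by rw [Finset.mem_Icc]; omega⟩ S.w ⟨2 * (n + 1), by rw [Finset.mem_Icc]; omega⟩
    ⟨-2 * n - 1, by rw [Finset.mem_Icc]; omega⟩

theorem opE_eq_pairOp (n : ℕ) (S : Weights K) : opE n S =
    pairOp S.x ⟨-(n + 1), by rw [Finset.mem_Icc]; omega⟩ ⟨-n, by rw [Finset.mem_Icc]; omega⟩ *
    pairOp S.y ⟨n + 1, by rw [Finset.mem_Icc]; omega⟩ ⟨n + 2, by rw [Finset.mem_Icc]; omega⟩ := by
  unfold opE R
  congr 2 <;> apply Subtype.ext <;> rw [Site.next_val] <;> simp only <;>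
    rw [if_neg (by push_cast; omega)] <;> ring

theorem opF_eq_pairOp (n : ℕ) (S : Weights K) : opF n S =
    pairOp S.z ⟨0, by rw [Finset.mem_Icc]; omega⟩ ⟨1, by rw [Finset.mem_Icc]; omega⟩ *
    pairOp S.w ⟨2 * (n + 1), by rw [Finset.mem_Icc]; omega⟩
      ⟨-2 * n - 1, by rw [Finset.mem_Icc]; omega⟩ := by
  unfold opF R
  congr 2
  apply Subtype.ext
  -- The second factor of f wraps around: the successor of 2(n+1) is -2(n+1) + 1 = -2n - 1.
  rw [Site.next_val, if_pos (by push_cast; omega)]; push_cast; ring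

/-- The inserted vectors are eigenvectors of the two factors of e. The eigenvalue is δ_L, so ē fixes
the image of `insertE`. -/
theorem opE_insertE (ψ : Word n →₀ K) :
    opE n S (insertE n S ψ) = (quantumTwo S.x * quantumTwo S.y) • insertE n S ψ := by
  have h := slots_skipE n
  rw [opE_eq_pairOp, Module.End.mul_apply, insertE]
  -- The factor at the second pair acts first, so the pairs are exchanged and then exchanged back.
  conv_lhs => rw [insertPairs_symm, pairOp_insertPairs_self h.symm, ← insertPairs_symm, map_smul,
    pairOp_insertPairs_self h, smul_smul, mul_comm]

theorem opF_insertF (ψ : Word n →₀ K) :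
    opF n S (insertF n S ψ) = (quantumTwo S.z * quantumTwo S.w) • insertF n S ψ := by
  have h := slots_skipF n
  rw [opF_eq_pairOp, Module.End.mul_apply, insertF]
  conv_lhs => rw [insertPairs_symm, pairOp_insertPairs_self h.symm, ← insertPairs_symm, map_smul,
    pairOp_insertPairs_self h, smul_smul, mul_comm]

theorem opE_mem_range (φ : Word (n + 1) →₀ K) : opE n S φ ∈ LinearMap.range (insertE n S) := by
  rw [opE_eq_pairOp]; exact pairOp_mem_range_insertPairs (slots_skipE n) φ

theorem opF_mem_range (φ : Word (n + 1) →₀ K) : opF n S φ ∈ LinearMap.range (insertF n S) := by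
  rw [opF_eq_pairOp]; exact pairOp_mem_range_insertPairs (slots_skipF n) φ

theorem insertE_R (hn : 0 < n) (a : Kˣ) {s s' : ℤ} (hs) (hs') (h₁ : s ≠ -n) (h₂ : s ≠ n)
    (e : s' = if s ≤ -n then s - 2 else if s ≤ n then s else s + 2) :
    Intertwines (insertE n S) (R n a s hs) (R (n + 1) a s' hs') :=
  intertwines_R hn (slots_skipE n) _ _ a hs hs' (Subtype.ext e.symm) (skipE_next _ h₁ h₂)

theorem insertF_R (hn : 0 < n) (a : Kˣ) {s s' : ℤ} (hs) (hs') (h₁ : s ≠ 0) (h₂ : s ≠ 2 * n)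
    (e : s' = if s ≤ 0 then s - 1 else s + 1) :
    Intertwines (insertF n S) (R n a s hs) (R (n + 1) a s' hs') :=
  intertwines_R hn (slots_skipF n) _ _ a hs hs' (Subtype.ext e.symm) (skipF_next _ h₁ h₂)

/-- The factors of f avoid the gaps made by `skipE`, and Σ_L keeps z and w. -/
theorem insertE_opF : Intertwines (insertE (m + 1) S) (opF m S.left) (opF (m + 1) S) := by
  unfold opF
  refine Intertwines.mul ?_ ?_ <;>
  · refine insertE_R (by omega) _ _ _ (by omega) (by omega) ?_
    split_ifs <;> omega

theorem insertF_opE : Intertwines (insertF (m + 1) S) (opE m S.right) (opE (m + 1) S) := by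
  unfold opE
  refine Intertwines.mul ?_ ?_ <;>
  · refine insertF_R (by omega) _ _ _ (by omega) (by omega) ?_
    split_ifs <;> omega

/-- The centres ∓(m+1) of the four positions move to ∓(m+2), so the outer positions move outwards by
two and the inner ones stay fixed only if the distance to the centre grows by one as well. Hence `i`
becomes `i.succ`. -/
theorem insertE_opU (i : Fin m) :
    Intertwines (insertE (m + 1) S) (opU m S.left i) (opU (m + 1) S i.succ) := by
  have := i.2
  unfold opU
  refine Intertwines.mul (Intertwines.mul (Intertwines.mul ?_ ?_) ?_) ?_ <;>
  · refine insertE_R (by omega) _ _ _ (by omega) (by omega) ?_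
    rw [Fin.val_succ]
    split_ifs <;> omega

/-- All four positions move by one together with the centres ∓(m+1), so their distance from the
centre, and with it the index of U, is unchanged. -/
theorem insertF_opU (i : Fin m) :
    Intertwines (insertF (m + 1) S) (opU m S.right i) (opU (m + 1) S i.castSucc) := by
  have := i.2
  unfold opU
  refine Intertwines.mul (Intertwines.mul (Intertwines.mul ?_ ?_) ?_) ?_ <;>
  · refine insertF_R (by omega) _ _ _ (by omega) (by omega) ?_
    rw [Fin.val_castSucc]
    split_ifs <;> omega

theorem R_congr (q : Kˣ) {s s' : ℤ} (hs) (hs') (h : s = s') : R n q s hs = R n q s' hs' := by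
  subst h; rfl

theorem opU_zero : opU (m + 1) S 0 =
    R (m + 1 + 1) S.a (-((m + 1 : ℕ) + 1) - 1) * R (m + 1 + 1) S.b (-(m + 1 : ℕ)) *
      R (m + 1 + 1) S.c (m + 1 : ℕ) * R (m + 1 + 1) S.d ((m + 1 : ℕ) + 2) := by
  unfold opU
  refine congrArg₂ (· * ·) (congrArg₂ (· * ·) (congrArg₂ (· * ·) ?_ ?_) ?_) ?_ <;>
  · refine R_congr _ _ _ ?_
    push_cast [Fin.val_zero, Fin.val_last]
    ring

theorem opU_last : opU (m + 1) S (Fin.last m) =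
    R (m + 1 + 1) S.a (-2 * (m + 1 : ℕ) - 1) * R (m + 1 + 1) S.b (-1) *
      R (m + 1 + 1) S.c 1 * R (m + 1 + 1) S.d (2 * (m + 1 : ℕ) + 1) := by
  unfold opU
  refine congrArg₂ (· * ·) (congrArg₂ (· * ·) (congrArg₂ (· * ·) ?_ ?_) ?_) ?_ <;>
  · refine R_congr _ _ _ ?_
    push_cast [Fin.val_zero, Fin.val_last]
    ring

/-- The factor of weight y commutes with those of weights a and b, so e U_1 splits into two
independent triples, each made of an operator at a removed pair and its two neighbours. -/
theorem opE_mul_opU : opE (m + 1) S * opU (m + 1) S 0 =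
    (R (m + 1 + 1) S.x (-((m + 1 : ℕ) + 1)) *
      (R (m + 1 + 1) S.a (-((m + 1 : ℕ) + 1) - 1) * R (m + 1 + 1) S.b (-(m + 1 : ℕ)))) *
    (R (m + 1 + 1) S.y ((m + 1 : ℕ) + 1) *
      (R (m + 1 + 1) S.c (m + 1 : ℕ) * R (m + 1 + 1) S.d ((m + 1 : ℕ) + 2))) := by
  rw [opU_zero, opE, mul_assoc (_ * _) (R _ S.c _ _), two_mul']
  apply Commute.mul_right <;> exact R_comm (by omega) _ _ _ _ (by unfold Far; push_cast; omega)

/-- The same splitting around 0 and around 2(m+2). On the cycle the neighbours of the latter are the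
factors of weights d and a, which stand at opposite ends of U, so a must first be commuted past the
rest. -/
theorem opF_mul_opU : opF (m + 1) S * opU (m + 1) S (Fin.last m) =
    (R (m + 1 + 1) S.z 0 * (R (m + 1 + 1) S.b (-1) * R (m + 1 + 1) S.c 1)) *
    (R (m + 1 + 1) S.w (2 * ((m + 1 : ℕ) + 1)) *
      (R (m + 1 + 1) S.d (2 * (m + 1 : ℕ) + 1) * R (m + 1 + 1) S.a (-2 * (m + 1 : ℕ) - 1))) := by
  have e : opU (m + 1) S (Fin.last m) = (R (m + 1 + 1) S.b (-1) * R (m + 1 + 1) S.c 1) *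
      (R (m + 1 + 1) S.d (2 * (m + 1 : ℕ) + 1) * R (m + 1 + 1) S.a (-2 * (m + 1 : ℕ) - 1)) := by
    rw [opU_last, mul_assoc, mul_assoc, ← mul_assoc (R _ S.b _ _), ← mul_assoc _ (R _ S.d _ _)]
    refine Commute.eq ?_
    repeat' first | apply Commute.mul_left | apply Commute.mul_right
    all_goals exact R_comm (by omega) _ _ _ _ (by unfold Far; push_cast; omega)
  rw [e, opF, two_mul']
  apply Commute.mul_right <;> exact R_comm (by omega) _ _ _ _ (by unfold Far; push_cast; omega)

/-- Each triple contracts to one operator across its removed pair, with parameters ab/x and cd/y.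
These are the weights of e in Σ_L. -/
theorem insertE_opE : Intertwines (insertE (m + 1) S) (opE m S.left)
    (opE (m + 1) S * opU (m + 1) S 0) := by
  rw [opE_mul_opU]
  unfold opE
  refine Intertwines.mul ?_ ?_
  · refine intertwines_contract (Nat.succ_pos m) (slots_skipE (m + 1)) _ _ _ _ _ _ ?_ ?_ ?_ ?_ <;>
      apply Subtype.ext <;> simp only [skipE_val, Site.next_val] <;> split_ifs <;> omega
  -- The second triple contracts the second inserted pair, which has to be moved into first place.
  · rw [insertE, insertPairs_symm]
    refine intertwines_contract (Nat.succ_pos m) (slots_skipE (m + 1)).symm _ _ _ _ _ _ ?_ ?_ ?_ ?_ <;>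
      apply Subtype.ext <;> simp only [skipE_val, Site.next_val] <;> split_ifs <;> omega

/-- The two contractions yield bc/z and da/w, the weights of f in Σ_R. -/
theorem insertF_opF : Intertwines (insertF (m + 1) S) (opF m S.right)
    (opF (m + 1) S * opU (m + 1) S (Fin.last m)) := by
  rw [opF_mul_opU]
  unfold opF
  refine Intertwines.mul ?_ ?_
  · refine intertwines_contract (Nat.succ_pos m) (slots_skipF (m + 1)) _ _ _ _ _ _ ?_ ?_ ?_ ?_ <;>
      apply Subtype.ext <;> simp only [skipF_val, Site.next_val] <;> split_ifs <;> omega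
  -- In cyclic order d precedes a, so the contraction gives da/w, whereas Σ_R is written with ad/w.
  · rw [insertF, insertPairs_symm, Weights.right, mul_comm S.a]
    refine intertwines_contract (Nat.succ_pos m) (slots_skipF (m + 1)).symm _ _ _ _ _ _ ?_ ?_ ?_ ?_ <;>
      apply Subtype.ext <;> simp only [skipF_val, Site.next_val] <;> split_ifs <;> omega

end sites

/-! ### Equivariance over the localised algebra, and the theorem. -/

section main

open CategoryTheory

universe u

variable {K : Type u} [Field K] {n : ℕ} {S : Weights K} {P : Params K}

theorem tensorRep_gen_e (h : Compatible (n + 1) S P) :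
    tensorRep h (Blob.gen P Gen.e) = opE n S := by simp [tensorRep, genVal]

theorem tensorRep_gen_f (h : Compatible (n + 1) S P) :
    tensorRep h (Blob.gen P Gen.f) = opF n S := by simp [tensorRep, genVal]

theorem tensorRep_gen_U (h : Compatible (n + 1) S P) (i : Fin n) :
    tensorRep h (Blob.gen P (Gen.U i)) = opU n S i := by simp [tensorRep, genVal]

theorem tensorRep_eBar (h : Compatible (n + 1) S P) :
    tensorRep h (eBar n P) = P.δL⁻¹ • opE n S := by rw [eBar, map_smul, tensorRep_gen_e]

theorem tensorRep_fBar (h : Compatible (n + 1) S P) :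
    tensorRep h (fBar n P) = P.δR⁻¹ • opF n S := by rw [fBar, map_smul, tensorRep_gen_f]

theorem eBar_insertE (h : Compatible (n + 1) S P) (hL : P.δL ≠ 0) (ψ : Word n →₀ K) :
    tensorRep h (eBar n P) (insertE n S ψ) = insertE n S ψ := by
  rw [tensorRep_eBar, LinearMap.smul_apply, opE_insertE, ← h.δL, inv_smul_smul₀ hL]

theorem fBar_insertF (h : Compatible (n + 1) S P) (hR : P.δR ≠ 0) (ψ : Word n →₀ K) :
    tensorRep h (fBar n P) (insertF n S ψ) = insertF n S ψ := by
  rw [tensorRep_fBar, LinearMap.smul_apply, opF_insertF, ← h.δR, inv_smul_smul₀ hR]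

/-- Since ē fixes inserted vectors, ē a ē acts on them as ē a. For f and the U_i the result is again
an inserted vector, so the outer ē disappears; for e it is needed for the contraction. -/
theorem toCornerL_insertE (h : Compatible (n + 1) S P) (hL : P.δL ≠ 0) (g : Gen n)
    (ψ : Word n →₀ K) :
    tensorRep h (toCornerL hL n (Blob.gen P.left g)).1 (insertE n S ψ) =
      insertE n S (tensorRep h.left (Blob.gen P.left g) ψ) := by
  cases g with
  | e =>
    -- The scalar δ_L of the image of e cancels the δ_L⁻¹ in the remaining ē, leaving exactly e U_1.
    rw [toCornerL, Blob.lift_gen, genVal, corner_val_smul, map_smul, LinearMap.smul_apply,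
      tensorRep_toCorner, eBar_insertE h hL, tensorRep_gen_U, tensorRep_gen_e, tensorRep_eBar,
      LinearMap.smul_apply, smul_inv_smul₀ hL, ← Module.End.mul_apply, insertE_opE ψ]
  | f =>
    rw [toCornerL, Blob.lift_gen, genVal, tensorRep_toCorner, eBar_insertE h hL, tensorRep_gen_f,
      tensorRep_gen_f, insertE_opF ψ, eBar_insertE h hL]
  | U i =>
    rw [toCornerL, Blob.lift_gen, genVal, tensorRep_toCorner, eBar_insertE h hL, tensorRep_gen_U,
      tensorRep_gen_U, insertE_opU i ψ, eBar_insertE h hL]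

theorem toCornerR_insertF (h : Compatible (n + 1) S P) (hR : P.δR ≠ 0) (g : Gen n)
    (ψ : Word n →₀ K) :
    tensorRep h (toCornerR hR n (Blob.gen P.right g)).1 (insertF n S ψ) =
      insertF n S (tensorRep h.right (Blob.gen P.right g) ψ) := by
  cases g with
  | f =>
    -- Here δ_R cancels against f̄ and leaves f times the last U.
    rw [toCornerR, Blob.lift_gen, genVal, corner_val_smul, map_smul, LinearMap.smul_apply,
      tensorRep_toCorner, fBar_insertF h hR, tensorRep_gen_U, tensorRep_gen_f, tensorRep_fBar,
      LinearMap.smul_apply, smul_inv_smul₀ hR, ← Module.End.mul_apply, insertF_opF ψ]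
  | e =>
    rw [toCornerR, Blob.lift_gen, genVal, tensorRep_toCorner, fBar_insertF h hR, tensorRep_gen_e,
      tensorRep_gen_e, insertF_opE ψ, fBar_insertF h hR]
  | U i =>
    rw [toCornerR, Blob.lift_gen, genVal, tensorRep_toCorner, fBar_insertF h hR, tensorRep_gen_U,
      tensorRep_gen_U, insertF_opU i ψ, fBar_insertF h hR]

/-- Localisation at `e` sends `M_{n+1}(r)` to `M_n(r)`. -/
theorem locE_permModule (h : Compatible (n + 1) S P) (hL : P.δL ≠ 0) (r : ℤ) :
    Nonempty ((locE n hL).obj (ModuleCat.of _ (permModule h r)) ≅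
      ModuleCat.of (Blob n P.left) (permModule h.left r)) :=
  truncation_permModule_iso h h.left (eBar_idem n hL) (toCornerL hL n) (insertE n S)
    (eBar_insertE h hL) (insertPairs_injective (slots_skipE n))
    -- ē is a scalar multiple of e, and the range of `insertE` is a subspace.
    (fun φ => by
      rw [tensorRep_eBar, LinearMap.smul_apply]
      exact Submodule.smul_mem _ _ (opE_mem_range φ))
    (toCornerL_insertE h hL) r (ones_insertPairs (slots_skipE n) _ _ r)

/-- Localisation at `f` sends `M_{n+1}(r)` to `M_n(r)`. -/
theorem locF_permModule (h : Compatible (n + 1) S P) (hR : P.δR ≠ 0) (r : ℤ) :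
    Nonempty ((locF n hR).obj (ModuleCat.of _ (permModule h r)) ≅
      ModuleCat.of (Blob n P.right) (permModule h.right r)) :=
  truncation_permModule_iso h h.right (fBar_idem n hR) (toCornerR hR n) (insertF n S)
    (fBar_insertF h hR) (insertPairs_injective (slots_skipF n))
    (fun φ => by
      rw [tensorRep_fBar, LinearMap.smul_apply]
      exact Submodule.smul_mem _ _ (opF_mem_range φ))
    (toCornerR_insertF h hR) r (ones_insertPairs (slots_skipF n) _ _ r)

end main

end SympBlob

theorem mainTheorem6 {K : Type*} [Field K] (n : ℕ) (S : SympBlob.Weights K)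
    (P : SympBlob.Params K) (h : SympBlob.Compatible (n + 1) S P)
    (r : ℤ) (hr₁ : -2 * ((n : ℤ) + 1) ≤ r) (hr₂ : r ≤ 2 * ((n : ℤ) + 1)) :
    (∀ hL : P.δL ≠ 0,
      (|r| ≤ 2 * (n : ℤ) →
        Nonempty ((SympBlob.locE n hL).obj (ModuleCat.of _ (SympBlob.permModule h r)) ≅
          ModuleCat.of (SympBlob.Blob n P.left) (SympBlob.permModule h.left r))) ∧
      (2 * (n : ℤ) < |r| →
        Limits.IsZero ((SympBlob.locE n hL).obj (ModuleCat.of _ (SympBlob.permModule h r))))) ∧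
    (∀ hR : P.δR ≠ 0,
      (|r| ≤ 2 * (n : ℤ) →
        Nonempty ((SympBlob.locF n hR).obj (ModuleCat.of _ (SympBlob.permModule h r)) ≅
          ModuleCat.of (SympBlob.Blob n P.right) (SympBlob.permModule h.right r))) ∧
      (2 * (n : ℤ) < |r| →
        Limits.IsZero ((SympBlob.locF n hR).obj (ModuleCat.of _ (SympBlob.permModule h r))))) := by
  -- The isomorphisms hold for every `r`. Outside the range |r| ≤ 2n their target has no basis
  -- words, and vanishing is carried back along them.
  exact ⟨fun hL => ⟨fun _ => SympBlob.locE_permModule h hL r, fun hr =>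
      (SympBlob.permModule_isZero h.left hr).of_iso (SympBlob.locE_permModule h hL r).some⟩,
    fun hR => ⟨fun _ => SympBlob.locF_permModule h hR r, fun hr =>
      (SympBlob.permModule_isZero h.right hr).of_iso (SympBlob.locF_permModule h hR r).some⟩⟩
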